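/- Let $T>0$, let $L\ge 1$ be an integer, and put $U=[0,T)\times[0,\tfrac1{TL})$. For $\Gamma\subseteq\{0,\dots,L-1\}^2$ let $M_\Gamma=\bigcup_{(k,m)\in\Gamma}\bigl(U+(kT,\tfrac m{TL})\bigr)$. An operator $H$ with spreading function $s_H\in L^2(\mathbb R^2)$ acts on a tempered distribution $x$ by $Hx=\iint s_H(\tau,\nu)\,M_\nu T_\tau x\,d\nu\,d\tau$ (weakly), where $(T_\tau x)(t)=x(t-\tau)$ and $(M_\nu x)(t)=e^{2\pi i\nu t}x(t)$; its norm is $\|H\|=\|s_H\|_{L^2(\mathbb R^2)}$. Let $\mathcal H_{M_\Gamma}$ be the space of operators whose spreading function vanishes a.e. outside $M_\Gamma$, and let $\mathcal X(\Delta)=\bigcup_{\mathrm{area}(M_\Gamma)\le\Delta}\mathcal H_{M_\Gamma}$. A signal $x$ stably identifies a set $\mathcal Q$ of operators if there are constants $0<\alpha\le\beta<\infty$ with $\alpha\|H_1-H_2\|\le\|H_1x-H_2x\|_{L^2(\mathbb R)}\le\beta\|H_1-H_2\|$ for all $H_1,H_2\in\mathcal Q$ (the responses being in $L^2(\mathbb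 R)$); it stably identifies a single operator $H$ in $\mathcal Q$ if there are such constants, which may depend on $H$, for $H_1=H$ and all $H_2\in\mathcal Q$. A property holds for almost all $H\in\mathcal X(\Delta)$ if, for each $\Gamma$ with $\mathrm{area}(M_\Gamma)\le\Delta$, the set of $H\in\mathcal H_{M_\Gamma}$ without it is shy (Haar null) and nowhere dense in $\mathcal H_{M_\Gamma}$. Write $s_{k,m}(t,f)=s_H(t+kT,f+\tfrac m{TL})\,e^{2\pi i(f+m/(TL))t}$ for $(t,f)\in U$. For $c\in\mathbb C^{\mathbb Z/L}$ let $A_c$ be the $L\times L^2$ matrix whose column with index $(k,m)$ has the entries $\tfrac1{TL}c_{k-p}e^{2\pi i pm/L}$, $0\le p<L$, and let $A_\Gamma$ consist of its columns with index in $\Gamma$. For $y\in L^2(\mathbb R)$ let $\mathcal Z_y(t,f)=\sum_{m\in\mathbb Z}y(t-mTL)e^{2\pi i mTLf}$ be its Zak transform ($L^2$-convergence on $[0,TL)\times[0,\tfrac1{TL})$), let $z(t,f)\in\mathbb C^L$ have the entries $\mathcal Z_y(t+pT,f)e^{-2\pi i pTf}$, $0\le p<L$, and let $Z=\int_U z(t,f)z(t,f)^H\,d(t,f)$.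 **Theorem.** Let $\Delta<1$. There is $c\in\mathbb C^{\mathbb Z/L}$ such that the Dirac train $x=\sum_{k\in\mathbb Z}c_k\,\delta(\cdot+kT)$ has the following properties. 1. Almost all $H\in\mathcal X(\Delta)$ are stably identified in $\mathcal X(\Delta)$ by $x$. Moreover, there are sets $\mathcal Q_1\subseteq\mathcal Q_2\subseteq\dots\subseteq\mathcal X(\Delta)$, each stably identified by $x$, whose union contains almost all $H\in\mathcal X(\Delta)$; and $x$ stably identifies $\mathcal H_{M_\Gamma}$ for each $\Gamma$ with $\mathrm{area}(M_\Gamma)\le\Delta$. 2. Almost all $H\in\mathcal X(\Delta)$ lie in some $\mathcal H_{M_\Gamma}$ with $\mathrm{area}(M_\Gamma)\le\Delta$ for which the functions $s_{k,m}$, $(k,m)\in\Gamma$, are linearly independent on $U$ (up to null sets). 3. Every $H$ as in 2 is stably identified in $\mathcal X(\Delta)$ by $x$ and is recovered from $y=Hx$ as follows. If the columns of $U_n$ span the null space of $Z$, then $\Gamma$ is the set of indices of the zero columns of $U_n^HA_c$. The matrix $A_\Gamma$ has full column rank, and for almost every $(t,f)\in U$ the vector $(s_{k,m}(t,f))_{(k,m)\in\Gamma}$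 is the unique solution $v$ of $A_\Gamma v=z(t,f)$. -/

import Mathlib

open MeasureTheory Filter Topology
open scoped SchwartzMap ENNReal ComplexConjugate Matrix Pointwise

noncomputable section

namespace OperatorId

/-! ### Signals and operators -/

/-- The translation operator `(T_τ x)(t) = x(t - τ)` on tempered distributions:
`⟨T_τ x, φ⟩ = ⟨x, φ(· + τ)⟩`. -/
def translation (τ : ℝ) : 𝓢'(ℝ, ℂ) →L[ℂ] 𝓢'(ℝ, ℂ) :=
  PointwiseConvergenceCLM.precomp ℂ (SchwartzMap.compSubConstCLM ℂ (-τ))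

/-- The pure tone `t ↦ e^{j2πνt}`. -/
def tone (ν : ℝ) : ℝ → ℂ := fun t => Complex.exp (2 * Real.pi * Complex.I * ν * t)

/-- The modulation operator `(M_ν x)(t) = e^{j2πνt} x(t)` on tempered distributions. -/
def modulation (ν : ℝ) : 𝓢'(ℝ, ℂ) →L[ℂ] 𝓢'(ℝ, ℂ) :=
  TemperedDistribution.smulLeftCLM ℂ (tone ν)

theorem norm_tone (ν t : ℝ) : ‖tone ν t‖ = 1 := by
  have : tone ν t = Complex.exp (((2 * Real.pi * ν * t : ℝ) : ℂ) * Complex.I) := by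
    unfold tone; congr 1; push_cast; ring
  rw [this, Complex.norm_exp_ofReal_mul_I]

theorem tone_iteratedDeriv (ν : ℝ) (n : ℕ) :
    iteratedDeriv n (tone ν) = fun t => (2 * Real.pi * Complex.I * ν) ^ n * tone ν t := by
  induction n with
  | zero => simp
  | succ n ih =>
    rw [iteratedDeriv_succ, ih]
    funext t
    have h1 : HasDerivAt (fun t : ℝ => 2 * Real.pi * Complex.I * ν * (t : ℂ))
        (2 * Real.pi * Complex.I * ν) t := by
      simpa using (Complex.ofRealCLM.hasDerivAt (x := t)).const_mul (2 * Real.pi * Complex.I * ν)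
    have h2 : HasDerivAt (tone ν) (tone ν t * (2 * Real.pi * Complex.I * ν)) t := h1.cexp
    rw [(h2.const_mul _).deriv]
    ring

/-- Tones have temperate growth, so `modulation` is the genuine multiplication operator. -/
theorem tone_hasTemperateGrowth (ν : ℝ) : (tone ν).HasTemperateGrowth := by
  refine ⟨?_, fun n => ⟨0, ‖(2 * Real.pi * Complex.I * ν : ℂ)‖ ^ n, fun t => ?_⟩⟩
  · unfold tone
    have : ContDiff ℝ (⊤ : ℕ∞) (fun t : ℝ => (t : ℂ)) := Complex.ofRealCLM.contDiff
    fun_prop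
  · rw [norm_iteratedFDeriv_eq_norm_iteratedDeriv, tone_iteratedDeriv]
    simp [norm_tone]

theorem modulation_translation_apply (ν τ : ℝ) (x : 𝓢'(ℝ, ℂ)) (φ : 𝓢(ℝ, ℂ)) :
    modulation ν (translation τ x) φ =
      x (SchwartzMap.compSubConstCLM ℂ (-τ) (SchwartzMap.smulLeftCLM ℂ (tone ν) φ)) := rfl

/-- The linear space of operators. An operator
`H x = ∫∫ s(τ, ν) M_ν T_τ x dν dτ` is given by its spreading function `s ∈ L²(ℝ²)`, and the inner
product and the norm of operators are those of the spreading functions. -/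
abbrev Op : Type := Lp ℂ 2 (volume : Measure (ℝ × ℝ))

/-- `y ∈ L²(ℝ)` is the response `H x` of the operator with spreading function `H` to the
(generalized) signal `x`: the identity `y = ∫∫ H(τ, ν) M_ν T_τ x dν dτ` holds in the weak sense,
i.e. when both sides are paired with an arbitrary Schwartz function. -/
def IsResponse (H : Op) (x : 𝓢'(ℝ, ℂ)) (y : Lp ℂ 2 (volume : Measure ℝ)) : Prop :=
  ∀ φ : 𝓢(ℝ, ℂ),
    Integrable (fun p : ℝ × ℝ => H p * modulation p.2 (translation p.1 x) φ) ∧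
      ∫ t, y t * φ t = ∫ p : ℝ × ℝ, H p * modulation p.2 (translation p.1 x) φ

/-- The responses `H₁ x`, `H₂ x` are in `L²(ℝ)` and
`α ‖H₁ - H₂‖ ≤ ‖H₁ x - H₂ x‖ ≤ β ‖H₁ - H₂‖`. -/
def StabilityBounds (x : 𝓢'(ℝ, ℂ)) (α β : ℝ) (H₁ H₂ : Op) : Prop :=
  ∃ y₁ y₂ : Lp ℂ 2 (volume : Measure ℝ), IsResponse H₁ x y₁ ∧ IsResponse H₂ x y₂ ∧
    α * ‖H₁ - H₂‖ ≤ ‖y₁ - y₂‖ ∧ ‖y₁ - y₂‖ ≤ β * ‖H₁ - H₂‖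

/-- `x` stably identifies the set `Q` of operators. -/
def StablyIdentifies (x : 𝓢'(ℝ, ℂ)) (Q : Set Op) : Prop :=
  ∃ α β : ℝ, 0 < α ∧ α ≤ β ∧ ∀ H₁ ∈ Q, ∀ H₂ ∈ Q, StabilityBounds x α β H₁ H₂

/-- `x` stably identifies the single operator `H` among all operators in `Q`. -/
def StablyIdentifiesIn (x : 𝓢'(ℝ, ℂ)) (Q : Set Op) (H : Op) : Prop :=
  ∃ α β : ℝ, 0 < α ∧ α ≤ β ∧ ∀ H' ∈ Q, StabilityBounds x α β H H'

/-! ### Support regions and operator classes -/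

/-- The fundamental cell `U = [0, T) × [0, 1/(TL))`. -/
def cell (T : ℝ) (L : ℕ) : Set (ℝ × ℝ) := Set.Ico 0 T ×ˢ Set.Ico 0 (1 / (T * L))

/-- The region `M_Γ`, the union of the cells `U + (kT, m/(TL))`, `(k, m) ∈ Γ`. -/
def region (T : ℝ) (L : ℕ) (Γ : Finset (Fin L × Fin L)) : Set (ℝ × ℝ) :=
  ⋃ i ∈ Γ, ((i.1 : ℝ) * T, (i.2 : ℝ) / (T * L)) +ᵥ cell T L

/-- The area of `M_Γ`. -/
def area (T : ℝ) (L : ℕ) (Γ : Finset (Fin L × Fin L)) : ℝ := volume.real (region T L Γ)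

/-- The operators whose spreading function is supported in `M_Γ`. -/
def opClass (T : ℝ) (L : ℕ) (Γ : Finset (Fin L × Fin L)) : Submodule ℂ Op where
  carrier := {H | ∀ᵐ p : ℝ × ℝ, p ∉ region T L Γ → H p = 0}
  zero_mem' := by
    filter_upwards [Lp.coeFn_zero ℂ 2 (volume : Measure (ℝ × ℝ))] with p hp _
    rw [hp]; rfl
  add_mem' := by
    intro a b ha hb
    filter_upwards [ha, hb, Lp.coeFn_add a b] with p h1 h2 h3 hp
    rw [h3, Pi.add_apply, h1 hp, h2 hp, add_zero]
  smul_mem' := by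
    intro c a ha
    filter_upwards [ha, Lp.coeFn_smul c a] with p h1 h3 hp
    rw [h3, Pi.smul_apply, h1 hp, smul_zero]

/-- `X(Δ)`, the operators whose spreading function is supported in some `M_Γ` of area at
most `Δ`. -/
def blindClass (T : ℝ) (L : ℕ) (Δ : ℝ) : Set Op :=
  ⋃ (Γ : Finset (Fin L × Fin L)) (_ : area T L Γ ≤ Δ), (opClass T L Γ : Set Op)

/-! ### Almost all operators -/

/-- Shy (Haar null) subsets of a normed space, the standard translation invariant substitute for
Lebesgue null sets in infinite dimension: `E` is contained in a Borel set all of whose translates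
are null for one and the same Borel measure that is positive and finite on some compact set. -/
def IsShy {V : Type*} [NormedAddCommGroup V] (E : Set V) : Prop :=
  letI : MeasurableSpace V := borel V
  ∃ B : Set V, E ⊆ B ∧ MeasurableSet B ∧ ∃ μ : Measure V,
    (∃ K : Set V, IsCompact K ∧ 0 < μ K ∧ μ K < ∞) ∧ ∀ v : V, μ (v +ᵥ B) = 0

/-- Almost all operators of `X(Δ)` lie in `P`: in each of the finitely many Hilbert spaces of
which `X(Δ)` is the union, the set of operators outside `P` is shy and nowhere dense. -/
def AlmostAll (T : ℝ) (L : ℕ) (Δ : ℝ) (P : Set Op) : Prop :=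
  ∀ Γ : Finset (Fin L × Fin L), area T L Γ ≤ Δ →
    IsShy {H : opClass T L Γ | (H : Op) ∉ P} ∧
      IsNowhereDense {H : opClass T L Γ | (H : Op) ∉ P}

/-! ### The probing signal -/

/-- The weighted `TL`-periodic train of Dirac impulses `∑_k c_k δ(t + kT)`, as a sum in the space
of tempered distributions. -/
def diracTrain (T : ℝ) {L : ℕ} (c : ZMod L → ℂ) : 𝓢'(ℝ, ℂ) :=
  ∑' k : ℤ, c (k : ZMod L) • TemperedDistribution.delta (-((k : ℝ) * T))

theorem summable_train {T : ℝ} (hT : 0 < T) :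
    Summable fun k : ℤ => ((1 + |(k : ℝ) * T|) ^ 2)⁻¹ := by
  have h : Summable fun k : ℤ => (T ^ 2)⁻¹ * (1 / (k : ℝ) ^ 2) :=
    (Real.summable_one_div_int_pow.2 (by norm_num)).mul_left _
  refine Summable.of_norm_bounded_eventually h ?_
  have h0 : ∀ᶠ k : ℤ in cofinite, k ≠ 0 := by
    simpa using (Set.finite_singleton (0 : ℤ)).eventually_cofinite_notMem
  filter_upwards [h0] with k hk
  have hk' : (0 : ℝ) < (k : ℝ) ^ 2 := by positivity
  rw [Real.norm_of_nonneg (by positivity), one_div, ← mul_inv]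
  apply inv_anti₀ (by positivity)
  have : T ^ 2 * (k : ℝ) ^ 2 = |(k : ℝ) * T| ^ 2 := by rw [sq_abs]; ring
  rw [this]
  gcongr
  linarith

/-- The series defining the Dirac train converges. -/
theorem hasSum_diracTrain {T : ℝ} (hT : 0 < T) {L : ℕ} [NeZero L] (c : ZMod L → ℂ) :
    HasSum (fun k : ℤ => c (k : ZMod L) •
      (TemperedDistribution.delta (-((k : ℝ) * T)) : 𝓢'(ℝ, ℂ))) (diracTrain T c) := by
  obtain ⟨C, hC0, hC⟩ : ∃ C : ℝ, 0 ≤ C ∧ ∀ k, ‖c k‖ ≤ C :=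
    ⟨∑ k, ‖c k‖, Finset.sum_nonneg fun _ _ => norm_nonneg _,
      fun k => Finset.single_le_sum (f := fun k => ‖c k‖) (fun _ _ => norm_nonneg _)
        (Finset.mem_univ k)⟩
  have hb : ∀ (f : 𝓢(ℝ, ℂ)) (k : ℤ), ‖c (k : ZMod L) * f (-((k : ℝ) * T))‖ ≤
      ((1 + |(k : ℝ) * T|) ^ 2)⁻¹ * (C * (2 ^ 2 *
        (Finset.Iic ((2, 0) : ℕ × ℕ)).sup (schwartzSeminormFamily ℂ ℝ ℂ) f)) := by
    intro f k
    have h := SchwartzMap.one_add_le_sup_seminorm_apply (𝕜 := ℂ) (m := (2, 0)) (k := 2) (n := 0)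
      le_rfl le_rfl f (-((k : ℝ) * T))
    simp only [norm_iteratedFDeriv_zero, Real.norm_eq_abs, abs_neg] at h
    rw [norm_mul, ← div_eq_inv_mul, le_div_iff₀' (by positivity)]
    calc (1 + |(k : ℝ) * T|) ^ 2 * (‖c (k : ZMod L)‖ * ‖f (-((k : ℝ) * T))‖)
        = ‖c (k : ZMod L)‖ * ((1 + |(k : ℝ) * T|) ^ 2 * ‖f (-((k : ℝ) * T))‖) := by ring
      _ ≤ _ := mul_le_mul (hC _) h (by positivity) hC0
  have hs : ∀ f : 𝓢(ℝ, ℂ), Summable fun k : ℤ => c (k : ZMod L) * f (-((k : ℝ) * T)) :=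
    fun f => Summable.of_norm_bounded ((summable_train hT).mul_right _) (hb f)
  let A : 𝓢(ℝ, ℂ) →L[ℂ] ℂ := SchwartzMap.mkCLMtoNormedSpace
    (fun f => ∑' k : ℤ, c (k : ZMod L) * f (-((k : ℝ) * T)))
    (fun f g => by
      rw [← (hs f).tsum_add (hs g)]
      exact tsum_congr fun k => by simp [mul_add])
    (fun a f => by
      rw [RingHom.id_apply, smul_eq_mul, ← tsum_mul_left]
      exact tsum_congr fun k => by simp [mul_left_comm])
    ⟨Finset.Iic (2, 0), (∑' k : ℤ, ((1 + |(k : ℝ) * T|) ^ 2)⁻¹) * (C * 2 ^ 2), by positivity,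
      fun f => by
        refine (tsum_of_norm_bounded ((summable_train hT).mul_right _).hasSum (hb f)).trans ?_
        rw [tsum_mul_right]
        apply le_of_eq; ring⟩
  have key : HasSum (fun k : ℤ => c (k : ZMod L) •
      (TemperedDistribution.delta (-((k : ℝ) * T)) : 𝓢'(ℝ, ℂ)))
      (ContinuousLinearMap.toPointwiseConvergenceCLM _ _ _ _ A : 𝓢'(ℝ, ℂ)) := by
    refine (PointwiseConvergenceCLM.tendsto_iff_forall_tendsto).2 fun f => ?_
    have := (hs f).hasSum
    refine Tendsto.congr (fun s => ?_) this
    simp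
  exact key.summable.hasSum

theorem diracTrain_apply {T : ℝ} (hT : 0 < T) {L : ℕ} [NeZero L] (c : ZMod L → ℂ)
    (φ : 𝓢(ℝ, ℂ)) :
    HasSum (fun k : ℤ => c (k : ZMod L) * φ (-((k : ℝ) * T))) (diracTrain T c φ) := by
  have h := (PointwiseConvergenceCLM.tendsto_iff_forall_tendsto).1 (hasSum_diracTrain hT c) φ
  refine Tendsto.congr (fun s => ?_) h
  simp

/-! ### The recovery algorithm -/

/-- The cell components `s_{k,m}(t, f) = s(t + kT, f + m/(TL)) e^{j2π(f + m/(TL))t}`. -/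
def cellComponent (T : ℝ) (L : ℕ) (H : Op) (i : Fin L × Fin L) (u : ℝ × ℝ) : ℂ :=
  H (u.1 + (i.1 : ℝ) * T, u.2 + (i.2 : ℝ) / (T * L)) * tone (u.2 + (i.2 : ℝ) / (T * L)) u.1

/-- The functions `s_{k,m}`, `(k, m) ∈ Γ`, are linearly independent on the fundamental cell. -/
def CellsIndependent (T : ℝ) (L : ℕ) (Γ : Finset (Fin L × Fin L)) (H : Op) : Prop :=
  ∀ a : Fin L × Fin L → ℂ,
    (∀ᵐ u ∂(volume.restrict (cell T L)), ∑ i ∈ Γ, conj (a i) * cellComponent T L H i u = 0) →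
      ∀ i ∈ Γ, a i = 0

/-- `ζ` is the Zak transform (with parameter `P`) of `y ∈ L²(ℝ)` on `[0, P) × [0, 1/P)`: the series
`∑_m y(t - mP) e^{j2πmPf}` converges to `ζ(t, f)` in `L²`. -/
def IsZakTransform (P : ℝ) (y : Lp ℂ 2 (volume : Measure ℝ)) (ζ : ℝ × ℝ → ℂ) : Prop :=
  MemLp ζ 2 (volume.restrict (Set.Ico 0 P ×ˢ Set.Ico 0 (1 / P))) ∧
    Tendsto (fun N : ℕ => eLpNorm
      (fun u : ℝ × ℝ => ζ u -
        ∑ m ∈ Finset.Icc (-(N : ℤ)) N, y (u.1 - (m : ℝ) * P) * tone ((m : ℝ) * P) u.2)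
      2 (volume.restrict (Set.Ico 0 P ×ˢ Set.Ico 0 (1 / P)))) atTop (𝓝 0)

/-- The vector `z(t, f)` with entries `ζ(t + pT, f) e^{-j2πpTf}`, where `ζ` is a Zak transform. -/
def zakVector (T : ℝ) (L : ℕ) (ζ : ℝ × ℝ → ℂ) (u : ℝ × ℝ) : Fin L → ℂ :=
  fun p => ζ (u.1 + (p : ℝ) * T, u.2) * tone (-((p : ℝ) * T)) u.2

/-- The correlation matrix `Z = ∫_U z(t, f) z(t, f)ᴴ d(t, f)`. -/
def correlationMatrix (T : ℝ) (L : ℕ) (ζ : ℝ × ℝ → ℂ) : Matrix (Fin L) (Fin L) ℂ :=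
  Matrix.of fun p q => ∫ u in cell T L, zakVector T L ζ u p * conj (zakVector T L ζ u q)

/-- The `L × L²` matrix `A_c` whose column with index `(k, m)` has the entries
`(TL)⁻¹ c_{k-p} e^{j2πpm/L}`, `p = 0, …, L - 1`. -/
def trainMatrix (T : ℝ) {L : ℕ} (c : ZMod L → ℂ) : Matrix (Fin L) (Fin L × Fin L) ℂ :=
  Matrix.of fun p i => (1 / (T * L) : ℂ) * c (((i.1 : ℕ) : ZMod L) - ((p : ℕ) : ZMod L)) *
    Complex.exp (2 * Real.pi * Complex.I * (p : ℕ) * (i.2 : ℕ) / L)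

/-- The submatrix `A_Γ` of the columns of `A_c` with indices in `Γ`. -/
def activeMatrix (T : ℝ) {L : ℕ} (c : ZMod L → ℂ) (Γ : Finset (Fin L × Fin L)) :
    Matrix (Fin L) Γ ℂ :=
  (trainMatrix T c).submatrix id Subtype.val

/-- The support set found from `ζ` is `Γ`: whenever the columns of `Un` span the null space of the
correlation matrix, the zero columns of `Unᴴ A_c` are exactly those with index in `Γ`. -/
def SupportRecovered (T : ℝ) {L : ℕ} (c : ZMod L → ℂ) (ζ : ℝ × ℝ → ℂ)
    (Γ : Finset (Fin L × Fin L)) : Prop :=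
  ∀ (r : ℕ) (Un : Matrix (Fin L) (Fin r) ℂ),
    Submodule.span ℂ (Set.range Un.col) =
        LinearMap.ker (Matrix.mulVecLin (correlationMatrix T L ζ)) →
      ∀ i : Fin L × Fin L, (Unᴴ * trainMatrix T c).col i = 0 ↔ i ∈ Γ

/-- `A_Γ` has full column rank and, at almost every point of the fundamental cell, the components
`s_{k,m}`, `(k, m) ∈ Γ`, of the spreading function form the unique solution of the linear
system `A_Γ v = z`. -/
def SpreadingRecovered (T : ℝ) {L : ℕ} (c : ZMod L → ℂ) (ζ : ℝ × ℝ → ℂ)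
    (Γ : Finset (Fin L × Fin L)) (H : Op) : Prop :=
  (activeMatrix T c Γ).rank = Γ.card ∧
    ∀ᵐ u ∂(volume.restrict (cell T L)), ∀ v : Γ → ℂ,
      activeMatrix T c Γ *ᵥ v = zakVector T L ζ u ↔ v = fun i : Γ => cellComponent T L H i.1 u

end OperatorId

end

open OperatorId

/-!
The Zak transform turns the probing of `H` by the train into linear algebra: at almost every point
of the cell, the Zak vector of the response is `A_c s`, where `s` is the vector of the cell
components of `H`, and the norm of the response is `√(TL)` times the `L²` norm of `A_c s`.

With the weights `c_j = t ^ w_j` for a convex sequence of exponents `w`, every maximal minor of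
`A_c` is a polynomial in `t`. After a suitable cyclic rotation of the rows, its lowest term comes
from the permutations that minimize a transport cost, and its coefficient is a block Vandermonde
determinant. Hence for generic `t` any `L` columns of `A_c` are linearly independent.

If `area M_Γ < 1`, then `Γ` has fewer than `L` elements. So a linear functional of `A_c s`
isolates any given component supported on `Γ`, which gives stability for a known support. If
moreover the components of `H` are linearly independent, then for each `j ∉ Γ'` in the support of
`H` a functional vanishing on the columns of `Γ'` keeps `H` at a positive distance from all
operators supported on `Γ'`. The null space of the Gram matrix `Z` is then the annihilator of the
columns of `Γ`, and full spark recovers `Γ` from it.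

Linear dependence of the components is a closed condition. On a line in a direction with linearly
independent components it holds at finitely many points only, so it is shy and nowhere dense.
-/

noncomputable section

namespace OperatorId

/-! ### Rotations and rearrangements -/

theorem exists_forall_le_of_periodic {α : Type*} [LinearOrder α] {F : ℕ → α} {L : ℕ}
    (hL : 0 < L) (hF : Function.Periodic F L) : ∃ s, ∀ n, F n ≤ F s := by
  obtain ⟨s, -, hs⟩ := Finset.exists_max_image (Finset.range L) F ⟨0, Finset.mem_range.2 hL⟩
  refine ⟨s, fun n => ?_⟩
  rw [← hF.map_mod_nat n]
  exact hs _ (Finset.mem_range.2 (Nat.mod_lt n hL))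

theorem card_val_sub_lt_eq_sum {ι : Type*} [Fintype ι] {L : ℕ} [NeZero L] (K : ι → ZMod L)
    (s : ℕ) {n : ℕ} (hn : n ≤ L) :
    (Finset.univ.filter fun q => (K q - s).val < n).card =
      ∑ i ∈ Finset.range n, (Finset.univ.filter fun q => K q = ((s + i : ℕ) : ZMod L)).card := by
  rw [Finset.card_eq_sum_card_fiberwise (f := fun q => (K q - s).val) (t := Finset.range n)
    fun q hq => by simpa using hq]
  refine Finset.sum_congr rfl fun i hi => congrArg Finset.card (Finset.ext fun q => ?_)
  have hin : i < n := Finset.mem_range.1 hi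
  have hval : ((i : ZMod L)).val = i := ZMod.val_natCast_of_lt (hin.trans_le hn)
  simp only [Finset.mem_filter, Finset.mem_univ, true_and, Nat.cast_add, ← sub_eq_iff_eq_add']
  constructor
  · rintro ⟨-, rfl⟩
    rw [ZMod.natCast_zmod_val]
  · intro h
    rw [h, hval]
    exact ⟨hin, rfl⟩

-- Start at a maximum of the excess of points over positions, which is periodic.
theorem exists_rotation_card_le {ι : Type*} [Fintype ι] {L : ℕ} [NeZero L]
    (hι : Fintype.card ι = L) (K : ι → ZMod L) :
    ∃ s : ZMod L, ∀ n ≤ L, (Finset.univ.filter fun q => (K q - s).val < n).card ≤ n := by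
  let F : ℕ → ℤ := fun x => ∑ i ∈ Finset.range x,
    (((Finset.univ.filter fun q => K q = (i : ZMod L)).card : ℤ) - 1)
  have hF : ∀ s, ∀ n ≤ L,
      F (s + n) = F s + (Finset.univ.filter fun q => (K q - s).val < n).card - n := by
    intro s n hn
    simp only [F, Finset.sum_range_add, card_val_sub_lt_eq_sum K s hn, Finset.sum_sub_distrib,
      Finset.sum_const, Finset.card_range, nsmul_eq_mul, mul_one, Nat.cast_sum]
    rw [Nat.cast_add (R := ℤ) s n]
    ring
  have hper : Function.Periodic F L := by
    intro s
    rw [hF s L le_rfl, Finset.filter_true_of_mem fun q _ => ZMod.val_lt _, Finset.card_univ, hι]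
    ring
  obtain ⟨s, hs⟩ := exists_forall_le_of_periodic (NeZero.pos L) hper
  refine ⟨s, fun n hn => ?_⟩
  have := hF s n hn ▸ hs (s + n)
  exact_mod_cast (by linarith :
    ((Finset.univ.filter fun q => (K q - (s : ZMod L)).val < n).card : ℤ) ≤ n)

theorem exists_sort_rotation {L : ℕ} [NeZero L] (K : Fin L → ZMod L) :
    ∃ (s : ZMod L) (π : Equiv.Perm (Fin L)), (Monotone fun p => (K (π p) - s).val) ∧
      ∀ p : Fin L, (p : ℕ) ≤ (K (π p) - s).val := by
  obtain ⟨s, hs⟩ := exists_rotation_card_le (Fintype.card_fin L) K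
  let π := Tuple.sort fun q => (K q - s).val
  have hπ : Monotone fun p => (K (π p) - s).val := Tuple.monotone_sort fun q => (K q - s).val
  refine ⟨s, π, hπ, fun p => ?_⟩
  by_contra! hlt
  have hsub : (Finset.Iic p).map π.toEmbedding ⊆
      Finset.univ.filter fun q => (K q - s).val < p := by
    intro r hr
    obtain ⟨q, hq, rfl⟩ := Finset.mem_map.1 hr
    exact Finset.mem_filter.2 ⟨Finset.mem_univ _, (hπ (Finset.mem_Iic.1 hq)).trans_lt hlt⟩
  have hcard := (Finset.card_le_card hsub).trans (hs p p.2.le)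
  rw [Finset.card_map, Fin.card_Iic] at hcard
  exact p.1.lt_irrefl hcard

theorem comp_perm_eq_of_sum_mul_le {n : ℕ} {κ : Fin n → ℤ} (hκ : Monotone κ)
    (σ : Equiv.Perm (Fin n))
    (h : ∑ p : Fin n, ((p : ℕ) : ℤ) * κ p ≤ ∑ p : Fin n, ((p : ℕ) : ℤ) * κ (σ p)) :
    κ ∘ σ = κ := by
  have hval : StrictMono fun p : Fin n => ((p : ℕ) : ℤ) := fun _ _ hpq => Int.ofNat_lt.2 hpq
  have hvary : Monovary (fun p : Fin n => ((p : ℕ) : ℤ)) κ := hval.monotone.monovary hκ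
  have hvary_comp : Monovary (fun p : Fin n => ((p : ℕ) : ℤ)) (κ ∘ σ) :=
    hvary.sum_mul_comp_perm_eq_sum_mul_iff.1 (hvary.sum_mul_comp_perm_le_sum_mul.antisymm h)
  have hmono : Monotone (κ ∘ σ) := by
    intro p q hpq
    by_contra! hlt
    exact hlt.ne (congrArg (κ ∘ σ) (hpq.antisymm (hval.le_iff_le.1 (hvary_comp hlt)))).symm
  exact Tuple.unique_monotone (τ := 1) hmono hκ

/-- The number of steps forward from `p` to `k` on a circle of `L` points; the truncated
subtraction is genuine for `p ≤ L`. -/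
def forwardDist (L p k : ℕ) : ℕ := (k + L - p) % L

theorem forwardDist_eq {L p k : ℕ} (hp : p < L) (hk : k < L) :
    (forwardDist L p k : ℤ) = if p ≤ k then (k : ℤ) - p else (k : ℤ) - p + L := by
  unfold forwardDist
  split_ifs with h
  · rw [show k + L - p = k - p + L by omega, Nat.add_mod_right, Nat.mod_eq_of_lt (by omega)]
    omega
  · rw [Nat.mod_eq_of_lt (by omega)]
    omega

/-- The cost of moving a point forward by `d` on a circle of `L` points. The linear term makes
going around the circle too expensive, and the quadratic one favours monotone assignments. -/
def forwardCost (L d : ℕ) : ℕ := L ^ 2 * d + d ^ 2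

theorem sum_sq_sub_lt {L : ℕ} [NeZero L] {κ : Fin L → ℕ} (hκL : ∀ p, κ p < L) :
    ∑ p : Fin L, ((κ p : ℤ) - (p : ℕ)) ^ 2 < (L : ℤ) ^ 3 := by
  calc ∑ p : Fin L, ((κ p : ℤ) - (p : ℕ)) ^ 2
      < ∑ _p : Fin L, (L : ℤ) ^ 2 := by
        refine Finset.sum_lt_sum_of_nonempty Finset.univ_nonempty fun p _ => sq_lt_sq' ?_ ?_ <;>
          grind
    _ = (L : ℤ) ^ 3 := by simp; ring

theorem sum_forwardCost_eq {L : ℕ} {κ : Fin L → ℕ} (hκL : ∀ p, κ p < L)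
    (hle : ∀ p : Fin L, (p : ℕ) ≤ κ p) :
    ((∑ p : Fin L, forwardCost L (forwardDist L p (κ p)) : ℕ) : ℤ) =
      (L : ℤ) ^ 2 * ∑ p : Fin L, ((κ p : ℤ) - (p : ℕ)) +
        ∑ p : Fin L, ((κ p : ℤ) - (p : ℕ)) ^ 2 := by
  simp only [forwardCost, Nat.cast_sum, Nat.cast_add, Nat.cast_mul, Nat.cast_pow,
    forwardDist_eq (Fin.is_lt _) (hκL _), hle, if_true, Finset.sum_add_distrib, Finset.mul_sum]

theorem le_comp_perm_of_sum_forwardCost_le {L : ℕ} {κ : Fin L → ℕ} (hκL : ∀ p, κ p < L)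
    (hle : ∀ p : Fin L, (p : ℕ) ≤ κ p) (σ : Equiv.Perm (Fin L))
    (hσ : ∑ p : Fin L, forwardCost L (forwardDist L p (κ (σ p))) ≤
      ∑ p : Fin L, forwardCost L (forwardDist L p (κ p))) (p : Fin L) :
    (p : ℕ) ≤ κ (σ p) := by
  have : NeZero L := ⟨(p.pos).ne'⟩
  by_contra! hlt
  let d : Fin L → ℤ := fun q => ((forwardDist L q (κ (σ q)) : ℕ) : ℤ)
  have hd : ∀ q, d q = if (q : ℕ) ≤ κ (σ q) then (κ (σ q) : ℤ) - (q : ℕ)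
      else (κ (σ q) : ℤ) - (q : ℕ) + L := fun q => forwardDist_eq q.2 (hκL _)
  have hsum : ∑ q : Fin L, ((κ q : ℤ) - (q : ℕ)) + L ≤ ∑ q, d q := by
    rw [Finset.sum_sub_distrib, ← Equiv.sum_comp σ, ← Finset.sum_sub_distrib,
      ← sub_nonneg, ← sub_sub, ← Finset.sum_sub_distrib, sub_nonneg]
    have hp : d p - ((κ (σ p) : ℤ) - (p : ℕ)) = L := by rw [hd, if_neg hlt.not_ge]; ring
    rw [← hp]
    refine Finset.single_le_sum (f := fun q => d q - ((κ (σ q) : ℤ) - (q : ℕ)))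
      (fun q _ => ?_) (Finset.mem_univ p)
    rw [hd]
    split_ifs <;> simp
  have hcost : (L : ℤ) ^ 2 * ∑ q, d q ≤
      ((∑ q : Fin L, forwardCost L (forwardDist L q (κ (σ q))) : ℕ) : ℤ) := by
    rw [Finset.mul_sum, Nat.cast_sum]
    refine Finset.sum_le_sum fun q _ => ?_
    simp only [forwardCost, Nat.cast_add, Nat.cast_mul, Nat.cast_pow, d]
    exact le_add_of_nonneg_right (sq_nonneg _)
  have hgap := mul_le_mul_of_nonneg_left hsum (sq_nonneg (L : ℤ))
  have hid := sum_forwardCost_eq hκL hle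
  have hσ' := Int.ofNat_le.2 hσ
  linarith [sum_sq_sub_lt hκL]

theorem comp_perm_eq_of_sum_forwardCost_le {L : ℕ} {κ : Fin L → ℕ} (hκ : Monotone κ)
    (hκL : ∀ p, κ p < L) (hle : ∀ p : Fin L, (p : ℕ) ≤ κ p) (σ : Equiv.Perm (Fin L))
    (hσ : ∑ p : Fin L, forwardCost L (forwardDist L p (κ (σ p))) ≤
      ∑ p : Fin L, forwardCost L (forwardDist L p (κ p))) :
    ∀ p, κ (σ p) = κ p := by
  have hcost : ((∑ p : Fin L, forwardCost L (forwardDist L p (κ (σ p))) : ℕ) : ℤ) ≤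
      (∑ p : Fin L, forwardCost L (forwardDist L p (κ p)) : ℕ) := Int.ofNat_le.2 hσ
  rw [sum_forwardCost_eq (fun p => hκL (σ p))
    (le_comp_perm_of_sum_forwardCost_le hκL hle σ hσ), sum_forwardCost_eq hκL hle] at hcost
  have hcomm : ∀ p q : Fin L, (κ q : ℤ) * (p : ℕ) = (p : ℕ) * κ q := fun _ _ => mul_comm _ _
  simp only [sub_sq, hcomm, Finset.sum_add_distrib, Finset.sum_sub_distrib, mul_assoc,
    ← Finset.mul_sum, Equiv.sum_comp σ fun p => (κ p : ℤ),
    Equiv.sum_comp σ fun p => (κ p : ℤ) ^ 2] at hcost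
  have hmono : Monotone fun p => (κ p : ℤ) := fun p q hpq => Int.ofNat_le.2 (hκ hpq)
  have hcomp := comp_perm_eq_of_sum_mul_le hmono σ (by linarith)
  exact fun p => Int.ofNat_inj.1 (congrFun hcomp p)

/-! ### Full spark of the train matrix -/

/-- A matrix with full spark: any set of columns not larger than the number of rows is linearly
independent. -/
def HasFullSpark {𝕜 m n : Type*} [Semiring 𝕜] [Fintype m] (A : Matrix m n 𝕜) : Prop :=
  ∀ Λ : Finset n, Λ.card ≤ Fintype.card m → LinearIndepOn 𝕜 A.col Λ

theorem coeff_det_C_mul_X_pow {n R : Type*} [Fintype n] [DecidableEq n] [CommRing R]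
    (a : Matrix n n R) (w : n → n → ℕ) (S : n → n → Prop) [∀ p q, Decidable (S p q)] {W : ℕ}
    (hW : ∀ σ : Equiv.Perm n, W = ∑ p, w p (σ p) ↔ ∀ p, S p (σ p)) :
    (Matrix.of fun p q => Polynomial.C (a p q) * Polynomial.X ^ w p q).det.coeff W =
      (Matrix.of fun p q => if S p q then a p q else 0).det := by
  rw [← Matrix.det_transpose, Matrix.det_apply', ← Matrix.det_transpose (Matrix.of _),
    Matrix.det_apply', Polynomial.finsetSum_coeff]
  refine Finset.sum_congr rfl fun σ _ => ?_
  simp only [Polynomial.coeff_intCast_mul, Matrix.transpose_apply, Matrix.of_apply,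
    Finset.prod_mul_distrib, ← map_prod, Finset.prod_pow_eq_pow_sum,
    Polynomial.coeff_C_mul_X_pow, hW]
  congr 1
  split_ifs with hS
  · exact Finset.prod_congr rfl fun p _ => (if_pos (hS p)).symm
  · obtain ⟨p, hp⟩ := not_forall.1 hS
    exact (Finset.prod_eq_zero (Finset.mem_univ p) (if_neg hp)).symm

theorem eq_zero_of_forall_sum_mul_pow_eq_zero {ι R : Type*} [CommRing R] [IsDomain R]
    (B : Finset ι) {x u : ι → R} (hx : Set.InjOn x B)
    (h : ∀ j < B.card, ∑ q ∈ B, u q * x q ^ j = 0) : ∀ q ∈ B, u q = 0 := by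
  let e := B.equivFin.symm
  have hsum : ∀ j : Fin B.card, ∑ k, u (e k) * x (e k) ^ (j : ℕ) = 0 := fun j =>
    (e.sum_comp fun q : B => u q * x q ^ (j : ℕ)).trans
      ((B.sum_coe_sort fun q => u q * x q ^ (j : ℕ)).trans (h j j.2))
  have hinj : Function.Injective fun k => x (e k) :=
    (Set.injOn_iff_injective.1 hx).comp e.injective
  intro q hq
  simpa [e] using congrFun (Matrix.eq_zero_of_forall_pow_sum_mul_pow_eq_zero hinj hsum)
    (B.equivFin ⟨q, hq⟩)

-- The fibres of the monotone `κ` are intervals, so each block is a scaled Vandermonde matrix.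
theorem det_block_vandermonde_ne_zero {L : ℕ} {R : Type*} [CommRing R] [IsDomain R]
    {κ : Fin L → ℕ} (hκ : Monotone κ) (s : ℕ) {x : Fin L → R} (hx0 : ∀ q, x q ≠ 0)
    (hx : ∀ q r, κ q = κ r → x q = x r → q = r) :
    (Matrix.of fun p q : Fin L => if κ q = κ p then x q ^ ((p : ℕ) + s) else 0).det ≠ 0 := by
  intro hdet
  obtain ⟨v, hv0, hv⟩ := Matrix.exists_mulVec_eq_zero_iff.2 hdet
  refine hv0 (funext fun q₀ => ?_)
  let B : Finset (Fin L) := Finset.univ.filter fun q => κ q = κ q₀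
  have hmem : ∀ {q}, q ∈ B ↔ κ q = κ q₀ := by simp [B]
  have hB : B.Nonempty := ⟨q₀, hmem.2 rfl⟩
  have hrow : ∀ p ∈ B, ∑ q ∈ B, x q ^ ((p : ℕ) + s) * v q = 0 := by
    intro p hp
    have := congrFun hv p
    simpa only [Matrix.mulVec, dotProduct, Matrix.of_apply, ite_mul, zero_mul, Pi.zero_apply,
      hmem.1 hp, ← Finset.sum_filter] using this
  have hcard : B.card ≤ B.max' hB + 1 - B.min' hB := by
    rw [← Fin.card_Icc]
    exact Finset.card_le_card fun q hq => Finset.mem_Icc.2 ⟨B.min'_le q hq, B.le_max' q hq⟩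
  have hinterval : ∀ j < B.card, ∃ p ∈ B, (p : ℕ) = j + B.min' hB := by
    intro j hj
    have hmax : j + B.min' hB ≤ B.max' hB := by omega
    refine ⟨⟨j + B.min' hB, hmax.trans_lt (Fin.is_lt _)⟩, hmem.2 (le_antisymm ?_ ?_), rfl⟩
    · exact (hκ (Fin.le_def.2 hmax)).trans_eq (hmem.1 (B.max'_mem hB))
    · exact (hmem.1 (B.min'_mem hB)).symm.trans_le (hκ (Fin.le_def.2 (Nat.le_add_left _ _)))
  have hzero := eq_zero_of_forall_sum_mul_pow_eq_zero B (x := x)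
    (u := fun q => x q ^ ((B.min' hB : ℕ) + s) * v q)
    (fun q hq r hr => hx q r ((hmem.1 hq).trans (hmem.1 hr).symm)) fun j hj => by
      obtain ⟨p, hp, hpj⟩ := hinterval j hj
      rw [← hrow p hp]
      refine Finset.sum_congr rfl fun q _ => ?_
      rw [hpj]
      ring
  exact (mul_eq_zero.1 (hzero q₀ (hmem.2 rfl))).resolve_left (pow_ne_zero _ (hx0 _))

theorem exists_polynomial_det {L : ℕ} {R : Type*} [CommRing R] [IsDomain R] {κ : Fin L → ℕ}
    (hκ : Monotone κ) (hκL : ∀ p, κ p < L) (hle : ∀ p : Fin L, (p : ℕ) ≤ κ p) (s : ℕ)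
    {x : Fin L → R} (hx0 : ∀ q, x q ≠ 0) (hx : ∀ q r, κ q = κ r → x q = x r → q = r) :
    ∃ D : Polynomial R, D ≠ 0 ∧ ∀ t : R, D.eval t =
      (Matrix.of fun p q : Fin L =>
        t ^ forwardCost L (forwardDist L p (κ q)) * x q ^ ((p : ℕ) + s)).det := by
  refine ⟨(Matrix.of fun p q : Fin L => Polynomial.C (x q ^ ((p : ℕ) + s)) *
    Polynomial.X ^ forwardCost L (forwardDist L p (κ q))).det, fun hdet => ?_, fun t => ?_⟩
  · refine det_block_vandermonde_ne_zero hκ s hx0 hx ?_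
    have hcoeff := coeff_det_C_mul_X_pow (Matrix.of fun p q : Fin L => x q ^ ((p : ℕ) + s))
      (fun p q => forwardCost L (forwardDist L p (κ q))) (fun p q => κ q = κ p)
      (W := ∑ p : Fin L, forwardCost L (forwardDist L p (κ p)))
      fun σ => ⟨fun h => comp_perm_eq_of_sum_forwardCost_le hκ hκL hle σ h.ge,
        fun h => by simp only [h]⟩
    simp only [Matrix.of_apply] at hcoeff
    rw [← hcoeff, hdet, Polynomial.coeff_zero]
  · rw [← Polynomial.coe_evalRingHom, RingHom.map_det]
    congr 1
    ext p q
    simp [mul_comm]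

/-- The weights `c_j = t ^ forwardCost L j`, with `t` to be chosen generically. -/
def costWeight (L : ℕ) (t : ℂ) (j : ZMod L) : ℂ := t ^ forwardCost L j.val

theorem trainMatrix_costWeight_apply {T : ℝ} {L : ℕ} [NeZero L] (t : ℂ) (s : ZMod L)
    (p : Fin L) (i : Fin L × Fin L) :
    trainMatrix T (costWeight L t) (Fin.ofNat L (p + s.val)) i = (1 / (T * L) : ℂ) *
      (t ^ forwardCost L (forwardDist L p (((i.1 : ℕ) : ZMod L) - s).val) *
        (Complex.exp (2 * Real.pi * Complex.I / L) ^ (i.2 : ℕ)) ^ ((p : ℕ) + s.val)) := by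
  have hroot := (Complex.isPrimitiveRoot_exp L (NeZero.ne L)).pow_eq_one
  have hval : (((i.1 : ℕ) : ZMod L) - (((p + s.val) % L : ℕ) : ZMod L)).val =
      forwardDist L p (((i.1 : ℕ) : ZMod L) - s).val := by
    rw [forwardDist, ← ZMod.val_natCast L (_ + L - p), Nat.cast_sub (by omega)]
    simp only [ZMod.natCast_mod, Nat.cast_add, ZMod.natCast_zmod_val, ZMod.natCast_self]
    ring_nf
  have hexp : Complex.exp (2 * Real.pi * Complex.I * ((p + s.val) % L : ℕ) * (i.2 : ℕ) / L) =
      (Complex.exp (2 * Real.pi * Complex.I / L) ^ (i.2 : ℕ)) ^ ((p : ℕ) + s.val) := by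
    rw [pow_eq_pow_mod _ (by rw [pow_right_comm, hroot, one_pow]), ← pow_mul, ← Complex.exp_nat_mul]
    congr 1
    push_cast
    ring
  simp only [trainMatrix, costWeight, Matrix.of_apply, Fin.ofNat, hval, hexp]
  ring

theorem exists_polynomial_linearIndepOn {T : ℝ} (hT : T ≠ 0) {L : ℕ} [NeZero L]
    (Λ : Finset (Fin L × Fin L)) (hΛ : Λ.card = L) :
    ∃ D : Polynomial ℂ, D ≠ 0 ∧ ∀ t : ℂ, D.eval t ≠ 0 →
      LinearIndepOn ℂ (trainMatrix T (costWeight L t)).col Λ := by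
  let e₀ : Fin L ≃ Λ := (Λ.equivFinOfCardEq hΛ).symm
  obtain ⟨s, π, hκ, hle⟩ := exists_sort_rotation fun q => (((e₀ q).1.1 : ℕ) : ZMod L)
  let e : Fin L ≃ Λ := π.trans e₀
  let x : Fin L → ℂ := fun q => Complex.exp (2 * Real.pi * Complex.I / L) ^ ((e q).1.2 : ℕ)
  have hx : ∀ q r, ((((e q).1.1 : ℕ) : ZMod L) - s).val = ((((e r).1.1 : ℕ) : ZMod L) - s).val →
      x q = x r → q = r := by
    intro q r hκqr hxqr
    have hfst := (ZMod.natCast_eq_natCast_iff' _ _ L).1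
      (sub_left_injective (ZMod.val_injective L hκqr))
    rw [Nat.mod_eq_of_lt (Fin.is_lt _), Nat.mod_eq_of_lt (Fin.is_lt _)] at hfst
    have hsnd := (Complex.isPrimitiveRoot_exp L (NeZero.ne L)).pow_inj (Fin.is_lt _)
      (Fin.is_lt _) hxqr
    exact e.injective (Subtype.ext (Prod.ext (Fin.ext hfst) (Fin.ext hsnd)))
  obtain ⟨D, hD0, hD⟩ := exists_polynomial_det hκ (fun p => ZMod.val_lt _) hle s.val
    (fun q => pow_ne_zero _ (Complex.exp_ne_zero _)) hx
  refine ⟨D, hD0, fun t ht => ?_⟩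
  have hscale : (1 / (T * L) : ℂ) ≠ 0 := one_div_ne_zero <|
    mul_ne_zero (Complex.ofReal_ne_zero.2 hT) (Nat.cast_ne_zero.2 (NeZero.ne L))
  let rows : Fin L → Fin L := fun p => Fin.ofNat L (p + s.val)
  have hdet : ((trainMatrix T (costWeight L t)).submatrix rows fun q => (e q).1).det ≠ 0 := by
    rw [hD] at ht
    convert mul_ne_zero (pow_ne_zero (Fintype.card (Fin L)) hscale) ht using 1
    rw [← Matrix.det_smul]
    congr 1
    ext p q
    exact trainMatrix_costWeight_apply t s p _
  rw [LinearIndepOn, ← linearIndependent_equiv e]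
  exact (Matrix.linearIndependent_cols_of_det_ne_zero hdet).of_comp (LinearMap.funLeft ℂ ℂ rows)

theorem exists_hasFullSpark_trainMatrix {T : ℝ} (hT : T ≠ 0) (L : ℕ) [NeZero L] :
    ∃ c : ZMod L → ℂ, HasFullSpark (trainMatrix T c) := by
  choose! D hD0 hD using exists_polynomial_linearIndepOn hT (L := L)
  let S := (Finset.univ : Finset (Finset (Fin L × Fin L))).filter fun Λ => Λ.card = L
  have hprod : ∏ Λ ∈ S, D Λ ≠ 0 :=
    Finset.prod_ne_zero_iff.2 fun Λ hΛ => hD0 Λ (Finset.mem_filter.1 hΛ).2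
  obtain ⟨t, ht⟩ : ∃ t : ℂ, (∏ Λ ∈ S, D Λ).eval t ≠ 0 := by
    by_contra! hzero
    exact hprod (Polynomial.funext fun t => by rw [hzero t, Polynomial.eval_zero])
  rw [Polynomial.eval_prod, Finset.prod_ne_zero_iff] at ht
  refine ⟨costWeight L t, fun Λ hΛ => ?_⟩
  rw [Fintype.card_fin] at hΛ
  obtain ⟨Λ', hsub, hcard⟩ := Finset.exists_superset_card_eq hΛ
    (by simpa using Nat.le_mul_of_pos_left L (NeZero.pos L))
  exact (hD Λ' hcard t (ht Λ' (Finset.mem_filter.2 ⟨Finset.mem_univ _, hcard⟩))).mono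
    (Finset.coe_subset.2 hsub)

/-! ### Square integrable functions -/

section SquareIntegrable

variable {α F : Type*} [MeasurableSpace α] [NormedAddCommGroup F] {μ : Measure α}

theorem eLpNorm_two_sq (f : α → F) (μ : Measure α) :
    eLpNorm f 2 μ ^ 2 = ∫⁻ x, ‖f x‖ₑ ^ 2 ∂μ := by
  simpa using eLpNorm_nnreal_pow_eq_lintegral (f := f) (μ := μ) (p := 2) two_ne_zero

theorem enorm_lp_sq (f : Lp F 2 μ) : ‖f‖ₑ ^ 2 = ∫⁻ x, ‖f x‖ₑ ^ 2 ∂μ := by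
  rw [Lp.enorm_def, eLpNorm_two_sq]

theorem memLp_two_of_lintegral_lt_top {f : α → F} (hf : AEStronglyMeasurable f μ)
    (h : ∫⁻ x, ‖f x‖ₑ ^ 2 ∂μ < ∞) : MemLp f 2 μ :=
  ⟨hf, (ENNReal.pow_lt_top_iff (n := 2)).1 (eLpNorm_two_sq f μ ▸ h) |>.resolve_right two_ne_zero⟩

end SquareIntegrable

theorem norm_sq_eq_sum_of_enorm_sq {F ι : Type*} {E : ι → Type*} [NormedAddCommGroup F]
    [∀ i, NormedAddCommGroup (E i)] (s : Finset ι) (f : F) (g : ∀ i, E i)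
    (h : ‖f‖ₑ ^ 2 = ∑ i ∈ s, ‖g i‖ₑ ^ 2) : ‖f‖ ^ 2 = ∑ i ∈ s, ‖g i‖ ^ 2 := by
  have := congrArg ENNReal.toReal h
  rw [ENNReal.toReal_sum fun i _ => by simp] at this
  simpa using this

/-! ### Tones -/

theorem continuous_tone_uncurry : Continuous fun p : ℝ × ℝ => tone p.1 p.2 := by
  unfold tone
  fun_prop

theorem enorm_tone (ν t : ℝ) : ‖tone ν t‖ₑ = 1 := by
  rw [← ofReal_norm, norm_tone, ENNReal.ofReal_one]

theorem tone_comm (a x : ℝ) : tone a x = tone x a := by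
  unfold tone
  congr 1
  ring

theorem tone_add (a b x : ℝ) : tone (a + b) x = tone a x * tone b x := by
  unfold tone
  rw [← Complex.exp_add]
  congr 1
  push_cast
  ring

theorem tone_apply_add (a x y : ℝ) : tone a (x + y) = tone a x * tone a y := by
  simp only [tone_comm a, tone_add]

theorem tone_zero (x : ℝ) : tone 0 x = 1 := by simp [tone]

/-! ### The cells -/

/-- The position `(kT, m/(TL))` of the cell with index `(k, m)`. -/
def corner (T : ℝ) (L : ℕ) (i : Fin L × Fin L) : ℝ × ℝ :=
  ((i.1 : ℝ) * T, (i.2 : ℝ) / (T * L))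

/-- The Hilbert space `L²(U)`, which contains the components `s_{k,m}`. -/
abbrev CellL2 (T : ℝ) (L : ℕ) : Type := Lp ℂ 2 (volume.restrict (cell T L))

variable {T : ℝ} {L : ℕ}

theorem measurableSet_cell : MeasurableSet (cell T L) := measurableSet_Ico.prod measurableSet_Ico

theorem volume_cell (hT : 0 < T) [NeZero L] : volume (cell T L) = ENNReal.ofReal (1 / L) := by
  rw [cell, Measure.volume_eq_prod, Measure.prod_prod, Real.volume_Ico, Real.volume_Ico,
    ← ENNReal.ofReal_mul (by linarith), sub_zero, sub_zero, mul_one_div, ← div_div,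
    div_self hT.ne']

theorem volume_cell_lt_top : volume (cell T L) < ∞ := by
  rw [cell, Measure.volume_eq_prod, Measure.prod_prod, Real.volume_Ico, Real.volume_Ico]
  exact ENNReal.mul_lt_top ENNReal.ofReal_lt_top ENNReal.ofReal_lt_top

theorem mem_cell_vadd {a u : ℝ × ℝ} : u ∈ a +ᵥ cell T L ↔ u - a ∈ cell T L := by
  rw [Set.mem_vadd_set_iff_neg_vadd_mem, vadd_eq_add, neg_add_eq_sub]

theorem natCast_eq_of_add_mul_mem_Ico {r x y : ℝ} {k l : ℕ} (hx : x ∈ Set.Ico 0 r)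
    (hy : y ∈ Set.Ico 0 r) (h : x + k * r = y + l * r) : k = l := by
  have hr : 0 < r := hx.1.trans_lt hx.2
  have hkl : (k : ℝ) < l + 1 := lt_of_mul_lt_mul_right (by linarith [hx.1, hy.2]) hr.le
  have hlk : (l : ℝ) < k + 1 := lt_of_mul_lt_mul_right (by linarith [hy.1, hx.2]) hr.le
  exact le_antisymm (Nat.lt_succ_iff.1 (by exact_mod_cast hkl))
    (Nat.lt_succ_iff.1 (by exact_mod_cast hlk))

theorem eq_of_add_corner_eq {u w : ℝ × ℝ} {i j : Fin L × Fin L} (hu : u ∈ cell T L)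
    (hw : w ∈ cell T L) (h : u + corner T L i = w + corner T L j) : i = j := by
  have hfst := congrArg Prod.fst h
  have hsnd := congrArg Prod.snd h
  simp only [corner, Prod.fst_add, Prod.snd_add] at hfst hsnd
  exact Prod.ext (Fin.ext (natCast_eq_of_add_mul_mem_Ico hu.1 hw.1 hfst))
    (Fin.ext (natCast_eq_of_add_mul_mem_Ico hu.2 hw.2 (by simpa only [mul_one_div] using hsnd)))

theorem add_corner_mem_region_iff {Γ : Finset (Fin L × Fin L)} {u : ℝ × ℝ} (hu : u ∈ cell T L)
    (i : Fin L × Fin L) : u + corner T L i ∈ region T L Γ ↔ i ∈ Γ := by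
  simp only [region, Set.mem_iUnion, mem_cell_vadd]
  constructor
  · rintro ⟨j, hj, hmem⟩
    rwa [eq_of_add_corner_eq hu hmem (sub_add_cancel _ (corner T L j)).symm]
  · exact fun hi => ⟨i, hi, (add_sub_cancel_right u (corner T L i)).symm ▸ hu⟩

theorem pairwiseDisjoint_cells (s : Set (Fin L × Fin L)) :
    s.PairwiseDisjoint fun i => corner T L i +ᵥ cell T L := by
  intro i _ j _ hij
  rw [Function.onFun, Set.disjoint_left]
  intro u hi hj
  exact hij (eq_of_add_corner_eq (mem_cell_vadd.1 hi) (mem_cell_vadd.1 hj) (by simp))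

theorem measurableSet_cell_vadd (a : ℝ × ℝ) : MeasurableSet (a +ᵥ cell T L) :=
  measurableSet_cell.const_vadd a

theorem measurableSet_region (Γ : Finset (Fin L × Fin L)) : MeasurableSet (region T L Γ) :=
  Finset.measurableSet_biUnion _ fun _ _ => measurableSet_cell_vadd _

theorem area_eq (hT : 0 < T) [NeZero L] (Γ : Finset (Fin L × Fin L)) :
    area T L Γ = Γ.card / L := by
  have hunion : region T L Γ = ⋃ i ∈ Γ, corner T L i +ᵥ cell T L := rfl
  rw [area, Measure.real, hunion, measure_biUnion_finset (pairwiseDisjoint_cells _)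
    fun _ _ => measurableSet_cell_vadd _]
  simp only [measure_vadd, volume_cell hT, Finset.sum_const, nsmul_eq_mul, ENNReal.toReal_mul,
    ENNReal.toReal_natCast]
  rw [ENNReal.toReal_ofReal (by positivity), mul_one_div]

theorem card_lt_of_area_lt_one (hT : 0 < T) [NeZero L] {Γ : Finset (Fin L × Fin L)}
    (h : area T L Γ < 1) : Γ.card < L := by
  rw [area_eq hT, div_lt_one (Nat.cast_pos.2 (NeZero.pos L))] at h
  exact_mod_cast h

theorem measurePreserving_add_corner (i : Fin L × Fin L) :
    MeasurePreserving (fun u : ℝ × ℝ => u + corner T L i) (volume.restrict (cell T L))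
      (volume.restrict (corner T L i +ᵥ cell T L)) := by
  have h := (measurePreserving_add_right volume (corner T L i)).restrict_preimage_emb
    (measurableEmbedding_addRight _) (corner T L i +ᵥ cell T L)
  convert h using 2
  ext u
  rw [Set.mem_preimage, mem_cell_vadd, add_sub_cancel_right]

theorem ae_add_corner_of_ae (i : Fin L × Fin L) {p : ℝ × ℝ → Prop} (h : ∀ᵐ u, p u) :
    ∀ᵐ u ∂volume.restrict (cell T L), p (u + corner T L i) :=
  (measurePreserving_add_corner i).quasiMeasurePreserving.ae (ae_restrict_of_ae h)

/-! ### The components of an operator -/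

theorem cellComponent_eq (H : Op) (i : Fin L × Fin L) (u : ℝ × ℝ) :
    cellComponent T L H i u = H (u + corner T L i) * tone (u.2 + (corner T L i).2) u.1 := rfl

theorem stronglyMeasurable_cellComponent (H : Op) (i : Fin L × Fin L) :
    StronglyMeasurable (cellComponent T L H i) := by
  refine ((Lp.stronglyMeasurable H).comp_measurable (by fun_prop)).mul ?_
  exact (continuous_tone_uncurry.comp (by fun_prop : Continuous fun u : ℝ × ℝ =>
    (u.2 + (i.2 : ℝ) / (T * L), u.1))).stronglyMeasurable

theorem lintegral_cellComponent (H : Op) (i : Fin L × Fin L) :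
    ∫⁻ u in cell T L, ‖cellComponent T L H i u‖ₑ ^ 2 =
      ∫⁻ p in corner T L i +ᵥ cell T L, ‖H p‖ₑ ^ 2 := by
  rw [← (measurePreserving_add_corner i).lintegral_comp_emb (measurableEmbedding_addRight _)]
  simp only [cellComponent_eq, enorm_mul, enorm_tone, mul_one]

theorem lintegral_cellComponent_le (H : Op) (i : Fin L × Fin L) :
    ∫⁻ u in cell T L, ‖cellComponent T L H i u‖ₑ ^ 2 ≤ ‖H‖ₑ ^ 2 := by
  rw [lintegral_cellComponent, enorm_lp_sq]
  exact setLIntegral_le_lintegral _ _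

theorem memLp_cellComponent (H : Op) (i : Fin L × Fin L) :
    MemLp (cellComponent T L H i) 2 (volume.restrict (cell T L)) :=
  memLp_two_of_lintegral_lt_top (stronglyMeasurable_cellComponent H i).aestronglyMeasurable
    ((lintegral_cellComponent_le H i).trans_lt (by simp))

theorem cellComponent_add_ae_eq (H K : Op) (i : Fin L × Fin L) :
    cellComponent T L (H + K) i =ᵐ[volume.restrict (cell T L)]
      cellComponent T L H i + cellComponent T L K i := by
  filter_upwards [ae_add_corner_of_ae i (Lp.coeFn_add H K)] with u hu
  rw [Pi.add_apply, cellComponent_eq, cellComponent_eq, cellComponent_eq, hu, Pi.add_apply,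
    add_mul]

theorem cellComponent_smul_ae_eq (a : ℂ) (H : Op) (i : Fin L × Fin L) :
    cellComponent T L (a • H) i =ᵐ[volume.restrict (cell T L)] a • cellComponent T L H i := by
  filter_upwards [ae_add_corner_of_ae i (Lp.coeFn_smul a H)] with u hu
  rw [Pi.smul_apply, cellComponent_eq, cellComponent_eq, hu, Pi.smul_apply, smul_mul_assoc]

/-- The map that takes an operator to its component `s_i`, as an element of `L²(U)`. -/
def cellMap (T : ℝ) (L : ℕ) (i : Fin L × Fin L) : Op →L[ℂ] CellL2 T L :=
  LinearMap.mkContinuous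
    { toFun := fun H => (memLp_cellComponent H i).toLp
      map_add' := fun H K => by
        rw [← MemLp.toLp_add]
        exact MemLp.toLp_congr _ _ (cellComponent_add_ae_eq H K i)
      map_smul' := fun a H => by
        rw [RingHom.id_apply, ← MemLp.toLp_const_smul]
        exact MemLp.toLp_congr _ _ (cellComponent_smul_ae_eq a H i) }
    1 fun H => by
      rw [one_mul, ← enorm_le_iff_norm_le, ← ENNReal.pow_le_pow_left_iff two_ne_zero,
        LinearMap.coe_mk, AddHom.coe_mk, Lp.enorm_toLp, eLpNorm_two_sq]
      exact lintegral_cellComponent_le H i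

theorem coeFn_cellMap (H : Op) (i : Fin L × Fin L) :
    cellMap T L i H =ᵐ[volume.restrict (cell T L)] cellComponent T L H i :=
  (memLp_cellComponent H i).coeFn_toLp

theorem coeFn_sum_smul_cellMap (s : Finset (Fin L × Fin L)) (a : Fin L × Fin L → ℂ) (H : Op) :
    (∑ i ∈ s, a i • cellMap T L i H : CellL2 T L) =ᵐ[volume.restrict (cell T L)]
      fun u => ∑ i ∈ s, a i * cellComponent T L H i u := by
  have hterm : ∀ᵐ u ∂volume.restrict (cell T L), ∀ i ∈ s,
      (a i • cellMap T L i H : CellL2 T L) u = a i * cellComponent T L H i u := by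
    refine (Finset.eventually_all s).2 fun i _ => ?_
    filter_upwards [Lp.coeFn_smul (a i) (cellMap T L i H), coeFn_cellMap H i] with u hsmul hcoe
    rw [hsmul, Pi.smul_apply, hcoe, smul_eq_mul]
  filter_upwards [hterm, Lp.coeFn_finsetSum s fun i => a i • cellMap T L i H] with u hu hsum
  rw [hsum, Finset.sum_apply]
  exact Finset.sum_congr rfl hu

theorem enorm_cellMap_sq (H : Op) (i : Fin L × Fin L) :
    ‖cellMap T L i H‖ₑ ^ 2 = ∫⁻ p in corner T L i +ᵥ cell T L, ‖H p‖ₑ ^ 2 := by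
  rw [← lintegral_cellComponent, ← eLpNorm_two_sq]
  exact congrArg (· ^ 2) (Lp.enorm_toLp (memLp_cellComponent H i))

theorem mem_opClass_iff {Γ : Finset (Fin L × Fin L)} {H : Op} :
    H ∈ opClass T L Γ ↔ ∀ᵐ p : ℝ × ℝ, p ∉ region T L Γ → H p = 0 := Iff.rfl

theorem norm_sq_eq_sum_cellMap {Γ : Finset (Fin L × Fin L)} {H : Op} (hH : H ∈ opClass T L Γ) :
    ‖H‖ ^ 2 = ∑ i ∈ Γ, ‖cellMap T L i H‖ ^ 2 := by
  apply norm_sq_eq_sum_of_enorm_sq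
  simp only [enorm_cellMap_sq]
  rw [← lintegral_biUnion_finset (pairwiseDisjoint_cells _)
    (fun _ _ => measurableSet_cell_vadd _), enorm_lp_sq]
  change _ = ∫⁻ p in region T L Γ, ‖H p‖ₑ ^ 2
  rw [← lintegral_indicator (measurableSet_region Γ)]
  refine lintegral_congr_ae ?_
  filter_upwards [mem_opClass_iff.1 hH] with p hp
  by_cases h : p ∈ region T L Γ
  · rw [Set.indicator_of_mem h]
  · rw [Set.indicator_of_notMem h, hp h, enorm_zero, zero_pow two_ne_zero]

theorem cellMap_eq_zero {Γ : Finset (Fin L × Fin L)} {H : Op} (hH : H ∈ opClass T L Γ)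
    {i : Fin L × Fin L} (hi : i ∉ Γ) : cellMap T L i H = 0 := by
  apply Lp.ext
  filter_upwards [coeFn_cellMap H i, Lp.coeFn_zero ℂ 2 (volume.restrict (cell T L)),
    ae_restrict_mem measurableSet_cell, ae_add_corner_of_ae i (mem_opClass_iff.1 hH)]
    with u hcoe hzero hu hsupp
  rw [hcoe, hzero, cellComponent_eq, hsupp (mt (add_corner_mem_region_iff hu i).1 hi), zero_mul,
    Pi.zero_apply]

theorem opClass_mono {Γ Γ' : Finset (Fin L × Fin L)} (h : Γ ⊆ Γ') :
    opClass T L Γ ≤ opClass T L Γ' := by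
  intro H hH
  rw [mem_opClass_iff] at hH ⊢
  filter_upwards [hH] with p hp hp'
  exact hp fun hmem => hp' (Set.biUnion_subset_biUnion_left h hmem)

theorem cellsIndependent_iff {Γ : Finset (Fin L × Fin L)} {H : Op} :
    CellsIndependent T L Γ H ↔ LinearIndepOn ℂ (fun i => cellMap T L i H) (Γ : Set _) := by
  have hcomb : ∀ a : Fin L × Fin L → ℂ,
      (∀ᵐ u ∂volume.restrict (cell T L), ∑ i ∈ Γ, a i * cellComponent T L H i u = 0) ↔
        ∑ i ∈ Γ, a i • cellMap T L i H = 0 := fun a => by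
    rw [Lp.eq_zero_iff_ae_eq_zero]
    exact eventually_congr <| (coeFn_sum_smul_cellMap Γ a H).mono fun u hu => by
      rw [hu, Pi.zero_apply]
  rw [linearIndepOn_finset_iff, CellsIndependent]
  constructor
  · intro h g hg i hi
    simpa using h (fun i => conj (g i)) (by simpa using (hcomb g).2 hg) i hi
  · intro h a ha i hi
    simpa using h (fun i => conj (a i)) ((hcomb _).1 ha) i hi

theorem memLp_indicator_translate (i : Fin L × Fin L) (g : CellL2 T L) :
    MemLp ((corner T L i +ᵥ cell T L).indicator fun p =>
      tone (-p.2) (p.1 - (corner T L i).1) * g (p - corner T L i)) 2 := by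
  rw [memLp_indicator_iff_restrict (measurableSet_cell_vadd _)]
  have hcomp : MemLp (fun p => g (p - corner T L i)) 2
      (volume.restrict (corner T L i +ᵥ cell T L)) := by
    rw [← (measurePreserving_add_corner i).map_eq,
      (measurableEmbedding_addRight _).memLp_map_measure_iff]
    simpa [Function.comp_def] using Lp.memLp g
  refine hcomp.of_le ?_ (ae_of_all _ fun p => by rw [norm_mul, norm_tone, one_mul])
  exact (continuous_tone_uncurry.comp (by fun_prop : Continuous fun p : ℝ × ℝ =>
    (-p.2, p.1 - (corner T L i).1))).aestronglyMeasurable.mul hcomp.1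

theorem exists_mem_opClass_singleton (i : Fin L × Fin L) (g : CellL2 T L) :
    ∃ H ∈ opClass T L {i}, cellMap T L i H = g := by
  have hcoe := (memLp_indicator_translate i g).coeFn_toLp
  refine ⟨(memLp_indicator_translate i g).toLp, mem_opClass_iff.2 ?_, Lp.ext ?_⟩
  · filter_upwards [hcoe] with p hp hreg
    have hnot : p ∉ corner T L i +ᵥ cell T L := fun hmem =>
      hreg (Set.mem_biUnion (Finset.mem_singleton_self i) hmem)
    rw [hp, Set.indicator_of_notMem hnot]
  · filter_upwards [coeFn_cellMap (memLp_indicator_translate i g).toLp i,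
      ae_restrict_mem measurableSet_cell, ae_add_corner_of_ae i hcoe] with u hcell hu hcorner
    rw [hcell, cellComponent_eq, hcorner,
      Set.indicator_of_mem (mem_cell_vadd.2 (by simpa using hu)), Prod.snd_add, Prod.fst_add,
      add_sub_cancel_right, add_sub_cancel_right, mul_right_comm, ← tone_add, neg_add_cancel,
      tone_zero, one_mul]

theorem exists_mem_opClass_cellMap_eq (Γ : Finset (Fin L × Fin L))
    (g : Fin L × Fin L → CellL2 T L) :
    ∃ H ∈ opClass T L Γ, ∀ i ∈ Γ, cellMap T L i H = g i := by
  choose H hH hg using fun i => exists_mem_opClass_singleton i (g i)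
  refine ⟨∑ i ∈ Γ, H i, sum_mem fun i hi => opClass_mono (Finset.singleton_subset_iff.2 hi) (hH i),
    fun i hi => ?_⟩
  rw [map_sum, Finset.sum_eq_single_of_mem i hi, hg]
  exact fun j _ hji => cellMap_eq_zero (hH j) (by simpa using hji.symm)

/-! ### Almost all operators have linearly independent components -/

theorem finite_setOf_not_linearIndependent_add_smul {K E ι : Type*} [Field K] [AddCommGroup E]
    [Module K E] [Finite ι] (s : ι → E) {e : ι → E} (he : LinearIndependent K e) :
    {z : K | ¬LinearIndependent K fun i => s i + z • e i}.Finite := by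
  classical
  have := Fintype.ofFinite ι
  obtain ⟨φ, hφ⟩ := (Fintype.linearCombination K e).exists_leftInverse_of_injective
    (LinearMap.ker_eq_bot.2 he.fintypeLinearCombination_injective)
  have hφe : ∀ j, φ (e j) = Pi.single j 1 := fun j => by
    simpa using LinearMap.congr_fun hφ (Pi.single j 1)
  -- `φ` maps a linear relation between the vectors `s j + z • e j` to an eigenvector of `M`.
  let M : Matrix ι ι K := Matrix.of fun i j => -φ (s j) i
  refine M.charpoly.roots.toFinset.finite_toSet.subset fun z hz => ?_
  obtain ⟨g, hg, i, hi⟩ := Fintype.not_linearIndependent_iff.1 hz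
  rw [Finset.mem_coe, Multiset.mem_toFinset, Polynomial.mem_roots M.charpoly_monic.ne_zero,
    Polynomial.IsRoot, Matrix.eval_charpoly]
  refine Matrix.exists_mulVec_eq_zero_iff.1 ⟨g, fun h => hi (congrFun h i), funext fun k => ?_⟩
  have hφg := congrFun (congrArg φ hg) k
  simp only [map_sum, map_smul, map_add, hφe, Finset.sum_apply, Pi.smul_apply, Pi.add_apply,
    smul_eq_mul, map_zero] at hφg
  rw [← hφg, Matrix.mulVec, dotProduct]
  refine Finset.sum_congr rfl fun j _ => ?_
  simp only [M, Matrix.sub_apply, Matrix.scalar_apply, Matrix.diagonal_apply, Matrix.of_apply,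
    Pi.single_apply, mul_ite, mul_one, mul_zero]
  ring

theorem memLp_polynomial_eval (P : Polynomial ℂ) :
    MemLp (fun u : ℝ × ℝ => P.eval (u.1 : ℂ)) 2 (volume.restrict (cell T L)) := by
  have hcont : Continuous fun u : ℝ × ℝ => P.eval (u.1 : ℂ) := by fun_prop
  obtain ⟨C, hC⟩ := ((isCompact_Icc (a := 0) (b := T)).prod
    (isCompact_Icc (a := 0) (b := 1 / (T * L)))).exists_bound_of_continuousOn hcont.continuousOn
  have : IsFiniteMeasure (volume.restrict (cell T L)) :=
    isFiniteMeasure_restrict.2 volume_cell_lt_top.ne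
  refine MemLp.of_bound hcont.aestronglyMeasurable C ?_
  filter_upwards [ae_restrict_mem measurableSet_cell] with u hu
  exact hC u (Set.prod_mono Set.Ico_subset_Icc_self Set.Ico_subset_Icc_self hu)

/-- Polynomials in the time variable, as elements of `L²(U)`. -/
def polynomialLp (T : ℝ) (L : ℕ) : Polynomial ℂ →ₗ[ℂ] CellL2 T L where
  toFun P := (memLp_polynomial_eval P).toLp
  map_add' P Q := by simp only [Polynomial.eval_add, ← MemLp.toLp_add]; rfl
  map_smul' a P := by
    simp only [Polynomial.eval_smul, RingHom.id_apply, ← MemLp.toLp_const_smul]; rfl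

theorem polynomialLp_injective (hT : 0 < T) [NeZero L] :
    Function.Injective (polynomialLp T L) := by
  rw [injective_iff_map_eq_zero]
  intro P hP
  by_contra hne
  have hae : ∀ᵐ u ∂volume.restrict (cell T L), P.eval ((u : ℝ × ℝ).1 : ℂ) = 0 :=
    (memLp_polynomial_eval P).coeFn_toLp.symm.trans (Lp.eq_zero_iff_ae_eq_zero.1 hP)
  have hroots : {x : ℝ | P.eval (x : ℂ) = 0}.Finite :=
    (Polynomial.finite_setOfPred_isRoot hne).preimage Complex.ofReal_injective.injOn
  have hnull : ∀ᵐ u : ℝ × ℝ, P.eval (u.1 : ℂ) ≠ 0 :=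
    Measure.quasiMeasurePreserving_fst.ae
      (measure_eq_zero_iff_ae_notMem.1 (hroots.measure_zero volume))
  have hcell : volume (cell T L) = 0 := by
    rw [← Measure.restrict_eq_zero, ← ae_eq_bot, ← eventually_false_iff_eq_bot]
    filter_upwards [hae, ae_restrict_of_ae hnull] with u hzero hnonzero using hnonzero hzero
  rw [volume_cell hT, ENNReal.ofReal_eq_zero] at hcell
  exact hcell.not_gt (one_div_pos.2 (Nat.cast_pos.2 (NeZero.pos L)))

theorem exists_linearIndependent_cellL2 (hT : 0 < T) [NeZero L] :
    ∃ e : Fin L × Fin L → CellL2 T L, LinearIndependent ℂ e :=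
  ⟨_, ((Polynomial.basisMonomials ℂ).linearIndependent.map'
    (polynomialLp T L) (LinearMap.ker_eq_bot.2 (polynomialLp_injective hT))).comp
    (fun i => (finProdFinEquiv i : ℕ)) (Fin.val_injective.comp finProdFinEquiv.injective)⟩

theorem IsShy.mono {V : Type*} [NormedAddCommGroup V] {E F : Set V} (hF : IsShy F) (h : E ⊆ F) :
    IsShy E := by
  obtain ⟨B, hB, hrest⟩ := hF
  exact ⟨B, h.trans hB, hrest⟩

section FiniteLines

variable {V : Type*} [NormedAddCommGroup V] [NormedSpace ℝ V] {E : Set V}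

theorem isShy_of_forall_finite_line (hE : IsClosed E) (w : V)
    (h : ∀ v, {t : ℝ | v + t • w ∈ E}.Finite) : IsShy E := by
  let _ : MeasurableSpace V := borel V
  have : BorelSpace V := ⟨rfl⟩
  have hcont : Continuous fun t : ℝ => t • w := by fun_prop
  have hcompact : IsCompact ((fun t : ℝ => t • w) '' Set.Icc 0 1) := isCompact_Icc.image hcont
  refine ⟨E, subset_rfl, hE.measurableSet,
    Measure.map (fun t : ℝ => t • w) (volume.restrict (Set.Icc 0 1)),
    ⟨_, hcompact, ?_, ?_⟩, fun v => ?_⟩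
  · refine lt_of_lt_of_le ?_ (Measure.le_map_apply hcont.aemeasurable _)
    rw [Measure.restrict_apply' measurableSet_Icc,
      Set.inter_eq_right.2 (Set.subset_preimage_image _ _), Real.volume_Icc]
    simp
  · rw [Measure.map_apply hcont.measurable hcompact.measurableSet]
    exact measure_lt_top _ _
  · rw [Measure.map_apply hcont.measurable (hE.vadd v).measurableSet]
    refine measure_mono_null (fun t ht => ?_) ((h (-v)).measure_zero _)
    exact Set.mem_vadd_set_iff_neg_vadd_mem.1 ht

theorem isNowhereDense_of_forall_finite_line (hE : IsClosed E) (w : V)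
    (h : ∀ v, {t : ℝ | v + t • w ∈ E}.Finite) : IsNowhereDense E := by
  rw [hE.isNowhereDense_iff, Set.eq_empty_iff_forall_notMem]
  intro v hv
  have hline : Tendsto (fun t : ℝ => v + t • w) (𝓝 0) (𝓝 v) := by
    simpa using (by fun_prop : Continuous fun t : ℝ => v + t • w).tendsto 0
  exact infinite_of_mem_nhds 0 (hline (mem_interior_iff_mem_nhds.1 hv)) (h v)

end FiniteLines

theorem AlmostAll.mono {Δ : ℝ} {P Q : Set Op} (hP : AlmostAll T L Δ P)
    (h : ∀ H ∈ blindClass T L Δ, H ∈ P → H ∈ Q) : AlmostAll T L Δ Q := by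
  intro Γ hΓ
  have hsub : {H : opClass T L Γ | (H : Op) ∉ Q} ⊆ {H : opClass T L Γ | (H : Op) ∉ P} :=
    fun H hH hHP => hH (h H (Set.mem_biUnion (Set.mem_ofPred.2 hΓ) H.2) hHP)
  exact ⟨(hP Γ hΓ).1.mono hsub, (hP Γ hΓ).2.mono hsub⟩

theorem isClosed_not_cellsIndependent (Γ : Finset (Fin L × Fin L)) :
    IsClosed {H : opClass T L Γ | ¬CellsIndependent T L Γ H} := by
  have hcont : Continuous fun (H : opClass T L Γ) (i : Γ) => cellMap T L i (H : Op) := by fun_prop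
  simp only [cellsIndependent_iff]
  exact (isOpen_setOfPred_linearIndependent.preimage hcont).isClosed_compl

theorem exists_direction_finite_not_cellsIndependent (hT : 0 < T) [NeZero L]
    (Γ : Finset (Fin L × Fin L)) :
    ∃ K ∈ opClass T L Γ, ∀ H, {t : ℝ | ¬CellsIndependent T L Γ (H + t • K)}.Finite := by
  obtain ⟨e, he⟩ := exists_linearIndependent_cellL2 (L := L) hT
  obtain ⟨K, hK, hKe⟩ := exists_mem_opClass_cellMap_eq Γ e
  refine ⟨K, hK, fun H => ?_⟩
  have hfinite := finite_setOf_not_linearIndependent_add_smul (fun i : Γ => cellMap T L i H)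
    (he.comp ((↑) : Γ → _) Subtype.val_injective)
  refine (hfinite.preimage Complex.ofReal_injective.injOn).subset fun t ht hind => ?_
  refine ht (cellsIndependent_iff.2 ?_)
  have hcell : (fun i : Γ => cellMap T L i (H + t • K)) =
      fun i : Γ => cellMap T L i H + (t : ℂ) • (e ∘ (↑)) i := by
    funext i
    rw [Function.comp_apply, ← hKe i i.2, ← map_smul, ← map_add]
    rfl
  rw [LinearIndepOn]
  exact hcell ▸ hind

theorem almostAll_cellsIndependent (hT : 0 < T) [NeZero L] (Δ : ℝ) :
    AlmostAll T L Δ {H | ∃ Γ : Finset (Fin L × Fin L), area T L Γ ≤ Δ ∧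
      H ∈ opClass T L Γ ∧ CellsIndependent T L Γ H} := by
  intro Γ hΓ
  have hsub : {H : opClass T L Γ | (H : Op) ∉ {H | ∃ Γ : Finset (Fin L × Fin L),
      area T L Γ ≤ Δ ∧ H ∈ opClass T L Γ ∧ CellsIndependent T L Γ H}} ⊆
      {H : opClass T L Γ | ¬CellsIndependent T L Γ H} :=
    fun H hH hind => hH ⟨Γ, hΓ, H.2, hind⟩
  obtain ⟨K, hK, hfinite⟩ := exists_direction_finite_not_cellsIndependent hT Γ
  have hline : ∀ H : opClass T L Γ, {t : ℝ | H + t • (⟨K, hK⟩ : opClass T L Γ) ∈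
      {H : opClass T L Γ | ¬CellsIndependent T L Γ H}}.Finite := fun H => hfinite H
  exact ⟨(isShy_of_forall_finite_line (isClosed_not_cellsIndependent Γ) _ hline).mono hsub,
    (isNowhereDense_of_forall_finite_line (isClosed_not_cellsIndependent Γ) _ hline).mono hsub⟩

/-! ### Fourier expansion on a fiber -/

theorem continuous_tone (ν : ℝ) : Continuous (tone ν) := by
  unfold tone
  fun_prop

theorem integrableOn_mul_tone {g : ℝ → ℂ} {s : Set ℝ} (hg : IntegrableOn g s) (ν : ℝ) :
    IntegrableOn (fun f => g f * tone ν f) s :=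
  Integrable.mul_bdd (c := 1) hg (continuous_tone ν).aestronglyMeasurable
    (ae_of_all _ fun f => (norm_tone ν f).le)

/-- The coefficients of the expansion of `g` into the tones of frequency `mP`, which are
`1/P`-periodic. -/
def fiberCoeff (P : ℝ) (g : ℝ → ℂ) (m : ℤ) : ℂ :=
  P * ∫ f in Set.Ico 0 (1 / P), g f * tone (-(m * P)) f

theorem fourierCoeffOn_eq_fiberCoeff {P : ℝ} (hP : 0 < 1 / P) (g : ℝ → ℂ) (m : ℤ) :
    fourierCoeffOn hP g m = fiberCoeff P g m := by
  rw [fourierCoeffOn_eq_integral, fiberCoeff, intervalIntegral.integral_of_le hP.le,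
    ← restrict_Ico_eq_restrict_Ioc, sub_zero, one_div_one_div, Complex.real_smul]
  congr 2 with f
  rw [smul_eq_mul, mul_comm, fourier_coe_apply, tone]
  congr 2
  have : (P : ℂ) ≠ 0 := by simpa using hP.ne'
  push_cast
  field_simp

theorem tsum_enorm_fiberCoeff {P : ℝ} (hP : 0 < P) {g : ℝ → ℂ}
    (hg : MemLp g 2 (volume.restrict (Set.Ico 0 (1 / P)))) :
    ∑' m : ℤ, ‖fiberCoeff P g m‖ₑ ^ 2 =
      ENNReal.ofReal P * ∫⁻ f in Set.Ico 0 (1 / P), ‖g f‖ₑ ^ 2 := by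
  have hinv : (0 : ℝ) < 1 / P := one_div_pos.2 hP
  have hparseval := hasSum_sq_fourierCoeffOn hinv (by rwa [← restrict_Ico_eq_restrict_Ioc])
  simp only [fourierCoeffOn_eq_fiberCoeff] at hparseval
  calc ∑' m : ℤ, ‖fiberCoeff P g m‖ₑ ^ 2
      = ENNReal.ofReal (∑' m : ℤ, ‖fiberCoeff P g m‖ ^ 2) := by
        rw [ENNReal.ofReal_tsum_of_nonneg (fun m => by positivity) hparseval.summable]
        simp only [ENNReal.ofReal_pow (norm_nonneg _), ofReal_norm]
    _ = ENNReal.ofReal (P * ∫ f in Set.Ico 0 (1 / P), ‖g f‖ ^ 2) := by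
        rw [hparseval.tsum_eq, intervalIntegral.integral_of_le hinv.le,
          ← restrict_Ico_eq_restrict_Ioc, sub_zero, ← one_div, one_div_one_div, smul_eq_mul]
    _ = ENNReal.ofReal P * ∫⁻ f in Set.Ico 0 (1 / P), ‖g f‖ₑ ^ 2 := by
        rw [ENNReal.ofReal_mul hP.le, ofReal_integral_eq_lintegral_ofReal
          (hg.integrable_norm_pow two_ne_zero) (ae_of_all _ fun _ => by positivity)]
        simp only [ENNReal.ofReal_pow (norm_nonneg _), ofReal_norm]

theorem fiberCoeff_tone {P : ℝ} (hP : 0 < P) (k m : ℤ) :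
    fiberCoeff P (tone (k * P)) m = if k = m then 1 else 0 := by
  have hinv : (0 : ℝ) < 1 / P := one_div_pos.2 hP
  have hPne : (P : ℂ) ≠ 0 := by exact_mod_cast hP.ne'
  simp only [fiberCoeff, ← tone_add]
  rw [integral_Ico_eq_integral_Ioc, ← intervalIntegral.integral_of_le hinv.le]
  split_ifs with h
  · simp [h, tone, hPne]
  · have hfreq : 2 * Real.pi * Complex.I * ((k * P + -(m * P) : ℝ) : ℂ) ≠ 0 := by
      have : (k : ℂ) * P + -(m * P) = (k - m) * P := by ring
      simp [this, hPne, sub_eq_zero, h, Real.pi_ne_zero]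
    have hperiod : 2 * Real.pi * Complex.I * ((k * P + -(m * P) : ℝ) : ℂ) * ((1 / P : ℝ) : ℂ) =
        (k - m : ℤ) * (2 * Real.pi * Complex.I) := by
      push_cast
      field_simp
      ring
    unfold tone
    rw [integral_exp_mul_complex hfreq, hperiod, Complex.exp_int_mul_two_pi_mul_I]
    simp

theorem fiberCoeff_sub_sum {P : ℝ} (hP : 0 < P) {g : ℝ → ℂ}
    (hg : IntegrableOn g (Set.Ico 0 (1 / P))) (s : Finset ℤ) (a : ℤ → ℂ) (m : ℤ) :
    fiberCoeff P (fun f => g f - ∑ k ∈ s, a k * tone (k * P) f) m =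
      fiberCoeff P g m - if m ∈ s then a m else 0 := by
  have htone : ∀ ν, IntegrableOn (tone ν) (Set.Ico 0 (1 / P)) := fun ν =>
    (continuous_tone ν).integrableOn_Icc.mono_set Set.Ico_subset_Icc_self
  have hterm : ∀ k ∈ s, IntegrableOn (fun f => a k * (tone (k * P) f * tone (-(m * P)) f))
      (Set.Ico 0 (1 / P)) := fun k _ => (integrableOn_mul_tone (htone _) _).const_mul _
  calc fiberCoeff P (fun f => g f - ∑ k ∈ s, a k * tone (k * P) f) m
      = fiberCoeff P g m - ∑ k ∈ s, a k * fiberCoeff P (tone (k * P)) m := by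
        simp only [fiberCoeff, sub_mul, Finset.sum_mul, mul_assoc]
        rw [integral_sub (integrableOn_mul_tone hg _) (integrable_finsetSum _ hterm),
          integral_finsetSum _ hterm, mul_sub, Finset.mul_sum]
        simp only [integral_const_mul, mul_left_comm]
    _ = fiberCoeff P g m - if m ∈ s then a m else 0 := by
        simp only [fiberCoeff_tone hP, mul_ite, mul_one, mul_zero, Finset.sum_ite_eq']

theorem lintegral_sub_sum_fiberCoeff {P : ℝ} (hP : 0 < P) {g : ℝ → ℂ}
    (hg : MemLp g 2 (volume.restrict (Set.Ico 0 (1 / P)))) (s : Finset ℤ) :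
    ENNReal.ofReal P *
        ∫⁻ f in Set.Ico 0 (1 / P), ‖g f - ∑ k ∈ s, fiberCoeff P g k * tone (k * P) f‖ₑ ^ 2 =
      ∑' m : {m // m ∉ s}, ‖fiberCoeff P g m‖ₑ ^ 2 := by
  have hpartial : MemLp (fun f => ∑ k ∈ s, fiberCoeff P g k * tone (k * P) f) 2
      (volume.restrict (Set.Ico 0 (1 / P))) :=
    memLp_finsetSum s fun k _ => (MemLp.of_bound (continuous_tone _).aestronglyMeasurable 1
      (ae_of_all _ fun f => (norm_tone _ f).le)).const_mul _
  refine (tsum_enorm_fiberCoeff hP (hg.sub hpartial)).symm.trans ?_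
  refine Eq.trans (tsum_congr fun m => ?_)
    (tsum_subtype {m | m ∉ s} fun m => ‖fiberCoeff P g m‖ₑ ^ 2).symm
  refine (congrArg (‖·‖ₑ ^ 2)
    (fiberCoeff_sub_sum hP (hg.integrable one_le_two) s (fiberCoeff P g) m)).trans ?_
  by_cases h : m ∈ s <;> simp [h]

/-! ### Inversion of the Zak transform -/

theorem measurePreserving_add_mul_Ico (P : ℝ) (n : ℤ) :
    MeasurePreserving (fun t : ℝ => t + n * P) (volume.restrict (Set.Ico 0 P))
      (volume.restrict (Set.Ico (n • P) ((n + 1) • P))) := by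
  have h := (measurePreserving_add_right volume (n * P)).restrict_preimage_emb
    (measurableEmbedding_addRight _) (Set.Ico (n • P) ((n + 1) • P))
  simp only [zsmul_eq_mul, Int.cast_add, Int.cast_one, add_mul, one_mul] at h ⊢
  rwa [Set.preimage_add_const_Ico, sub_self, add_sub_cancel_left] at h

theorem lintegral_eq_tsum_translates {P : ℝ} (hP : 0 < P) (f : ℝ → ℝ≥0∞) :
    ∫⁻ x, f x = ∑' n : ℤ, ∫⁻ t in Set.Ico 0 P, f (t + n * P) := by
  rw [← setLIntegral_univ, ← iUnion_Ico_zsmul hP, lintegral_iUnion (fun _ => measurableSet_Ico)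
    (Set.pairwise_disjoint_Ico_zsmul P)]
  exact tsum_congr fun n => ((measurePreserving_add_mul_Ico P n).lintegral_comp_emb
    (measurableEmbedding_addRight _) f).symm

theorem hasSum_integral_translates {P : ℝ} (hP : 0 < P) {f : ℝ → ℂ} (hf : Integrable f) :
    HasSum (fun n : ℤ => ∫ t in Set.Ico 0 P, f (t + n * P)) (∫ x, f x) := by
  have h := hasSum_integral_iUnion (fun _ => measurableSet_Ico)
    (Set.pairwise_disjoint_Ico_zsmul P) hf.integrableOn
  rw [iUnion_Ico_zsmul hP, setIntegral_univ] at h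
  exact h.congr_fun fun n => (measurePreserving_add_mul_Ico P n).integral_comp
    (measurableEmbedding_addRight _) f

/-- The rectangle `[0, P) × [0, 1/P)`, on which a Zak transform with parameter `P` lives. -/
abbrev zakDomain (P : ℝ) : Set (ℝ × ℝ) := Set.Ico 0 P ×ˢ Set.Ico 0 (1 / P)

/-- The function on the line whose Zak transform on `[0, P) × [0, 1/P)` is `G`. -/
def invZak (P : ℝ) (G : ℝ × ℝ → ℂ) (x : ℝ) : ℂ :=
  fiberCoeff P (fun f => G (x - ⌊x / P⌋ * P, f)) (-⌊x / P⌋)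

theorem invZak_apply {P : ℝ} (hP : 0 < P) (G : ℝ × ℝ → ℂ) {t : ℝ} (ht : t ∈ Set.Ico 0 P)
    (m : ℤ) : invZak P G (t - m * P) = fiberCoeff P (fun f => G (t, f)) m := by
  have hfloor : ⌊(t - m * P) / P⌋ = -m := by
    rw [sub_div, mul_div_cancel_right₀ _ hP.ne', Int.floor_sub_intCast,
      Int.floor_eq_zero_iff.2 ⟨div_nonneg ht.1 hP.le, (div_lt_one hP).2 ht.2⟩, zero_sub]
  rw [invZak, hfloor, neg_neg, Int.cast_neg, neg_mul, sub_neg_eq_add, sub_add_cancel]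

section

variable {P : ℝ} {G : ℝ × ℝ → ℂ}

theorem stronglyMeasurable_invZak (P : ℝ) (hG : Measurable G) :
    StronglyMeasurable (invZak P G) := by
  unfold invZak fiberCoeff
  refine StronglyMeasurable.const_mul (StronglyMeasurable.integral_prod_right
    (f := fun x f => G (x - ⌊x / P⌋ * P, f) * tone (-((-⌊x / P⌋ : ℤ) * P)) f)
    (Measurable.stronglyMeasurable ?_)) _
  have hfloor : Measurable fun p : ℝ × ℝ => ((⌊p.1 / P⌋ : ℤ) : ℝ) :=
    measurable_from_top.comp (Int.measurable_floor.comp (by fun_prop))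
  refine (hG.comp (by fun_prop : Measurable fun p : ℝ × ℝ =>
    (p.1 - ⌊p.1 / P⌋ * P, p.2))).mul ?_
  refine continuous_tone_uncurry.measurable.comp (?_ : Measurable fun p : ℝ × ℝ =>
    (-((-⌊p.1 / P⌋ : ℤ) * P), p.2))
  push_cast
  fun_prop

theorem measurable_fiberCoeff (P : ℝ) (hG : Measurable G) (m : ℤ) :
    Measurable fun t => fiberCoeff P (fun f => G (t, f)) m :=
  (StronglyMeasurable.const_mul (StronglyMeasurable.integral_prod_right
    (f := fun t f => G (t, f) * tone (-(m * P)) f)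
    (hG.mul ((continuous_tone _).measurable.comp measurable_snd)).stronglyMeasurable)
    _).measurable

theorem ae_memLp_fiber (hG : Measurable G) (hG2 : MemLp G 2 (volume.restrict (zakDomain P))) :
    ∀ᵐ t ∂volume.restrict (Set.Ico 0 P),
      MemLp (fun f => G (t, f)) 2 (volume.restrict (Set.Ico 0 (1 / P))) := by
  have hfin := ENNReal.pow_lt_top (n := 2) hG2.2
  rw [eLpNorm_two_sq, Measure.volume_eq_prod, setLIntegral_prod _ (by fun_prop)] at hfin
  have hmeas : Measurable fun u : ℝ × ℝ => ‖G u‖ₑ ^ 2 := by fun_prop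
  filter_upwards [ae_lt_top hmeas.lintegral_prod_right' hfin.ne] with t ht
  exact memLp_two_of_lintegral_lt_top
    (hG.comp (by fun_prop : Measurable fun f : ℝ => (t, f))).aestronglyMeasurable ht

theorem tsum_lintegral_fiberCoeff (hP : 0 < P) (hG : Measurable G)
    (hG2 : MemLp G 2 (volume.restrict (zakDomain P))) :
    ∑' m : ℤ, ∫⁻ t in Set.Ico 0 P, ‖fiberCoeff P (fun f => G (t, f)) m‖ₑ ^ 2 =
      ENNReal.ofReal P * ∫⁻ u in zakDomain P, ‖G u‖ₑ ^ 2 := by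
  have hmeas : Measurable fun u : ℝ × ℝ => ‖G u‖ₑ ^ 2 := by fun_prop
  rw [← lintegral_tsum fun m => ((measurable_fiberCoeff P hG m).enorm.pow_const 2).aemeasurable,
    Measure.volume_eq_prod, setLIntegral_prod _ (by fun_prop),
    ← lintegral_const_mul _ hmeas.lintegral_prod_right']
  refine lintegral_congr_ae ?_
  filter_upwards [ae_memLp_fiber hG hG2] with t ht using tsum_enorm_fiberCoeff hP ht

theorem lintegral_invZak (hP : 0 < P) (hG : Measurable G)
    (hG2 : MemLp G 2 (volume.restrict (zakDomain P))) :
    ∫⁻ x, ‖invZak P G x‖ₑ ^ 2 = ENNReal.ofReal P * ∫⁻ u in zakDomain P, ‖G u‖ₑ ^ 2 := by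
  rw [← tsum_lintegral_fiberCoeff hP hG hG2, lintegral_eq_tsum_translates hP,
    ← (Equiv.neg ℤ).tsum_eq]
  refine tsum_congr fun m => setLIntegral_congr_fun measurableSet_Ico fun t ht => ?_
  simp only [Equiv.neg_apply, Int.cast_neg, neg_mul, ← sub_eq_add_neg, invZak_apply hP G ht m]

theorem mul_lintegral_zakDomain_lt_top (hG2 : MemLp G 2 (volume.restrict (zakDomain P))) :
    ENNReal.ofReal P * ∫⁻ u in zakDomain P, ‖G u‖ₑ ^ 2 < ∞ := by
  rw [← eLpNorm_two_sq]
  exact ENNReal.mul_lt_top ENNReal.ofReal_lt_top (ENNReal.pow_lt_top hG2.2)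

theorem memLp_invZak (hP : 0 < P) (hG : Measurable G)
    (hG2 : MemLp G 2 (volume.restrict (zakDomain P))) : MemLp (invZak P G) 2 volume :=
  memLp_two_of_lintegral_lt_top (stronglyMeasurable_invZak P hG).aestronglyMeasurable
    (lintegral_invZak hP hG hG2 ▸ mul_lintegral_zakDomain_lt_top hG2)

theorem lintegral_zak_remainder (hP : 0 < P) (hG : Measurable G)
    (hG2 : MemLp G 2 (volume.restrict (zakDomain P))) (s : Finset ℤ) :
    ∫⁻ u in zakDomain P,
        ‖G u - ∑ m ∈ s, fiberCoeff P (fun f => G (u.1, f)) m * tone (m * P) u.2‖ₑ ^ 2 =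
      (ENNReal.ofReal P)⁻¹ * ∑' m : {m // m ∉ s},
        ∫⁻ t in Set.Ico 0 P, ‖fiberCoeff P (fun f => G (t, f)) m‖ₑ ^ 2 := by
  have hP0 : ENNReal.ofReal P ≠ 0 := (ENNReal.ofReal_pos.2 hP).ne'
  have hmeas : Measurable fun u : ℝ × ℝ =>
      ‖G u - ∑ m ∈ s, fiberCoeff P (fun f => G (u.1, f)) m * tone (m * P) u.2‖ₑ ^ 2 := by
    refine (hG.sub (Finset.measurable_fun_sum _ fun m _ => ?_)).enorm.pow_const 2
    exact ((measurable_fiberCoeff P hG m).comp measurable_fst).mul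
      ((continuous_tone _).measurable.comp measurable_snd)
  rw [Measure.volume_eq_prod, setLIntegral_prod _ hmeas.aemeasurable,
    ← lintegral_tsum fun m : {m // m ∉ s} =>
      ((measurable_fiberCoeff P hG m.1).enorm.pow_const 2).aemeasurable,
    ← lintegral_const_mul' _ _ (ENNReal.inv_ne_top.2 hP0)]
  refine lintegral_congr_ae ?_
  filter_upwards [ae_memLp_fiber hG hG2] with t ht
  rw [← lintegral_sub_sum_fiberCoeff hP ht, ← mul_assoc,
    ENNReal.inv_mul_cancel hP0 ENNReal.ofReal_ne_top, one_mul]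

end

theorem quasiMeasurePreserving_fst_sub (a : ℝ) :
    Measure.QuasiMeasurePreserving (fun u : ℝ × ℝ => u.1 - a) volume volume :=
  (measurePreserving_sub_right volume a).quasiMeasurePreserving.comp
    Measure.quasiMeasurePreserving_fst

theorem isZakTransform_of_ae_eq_invZak {P : ℝ} (hP : 0 < P) {G : ℝ × ℝ → ℂ} (hG : Measurable G)
    (hG2 : MemLp G 2 (volume.restrict (zakDomain P))) {y : Lp ℂ 2 (volume : Measure ℝ)}
    (hy : y =ᵐ[volume] invZak P G) : IsZakTransform P y G := by
  have hcoeff : ∀ᵐ u ∂volume.restrict (zakDomain P), ∀ m : ℤ,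
      y (u.1 - m * P) = fiberCoeff P (fun f => G (u.1, f)) m := by
    rw [ae_all_iff]
    intro m
    filter_upwards [ae_restrict_of_ae ((quasiMeasurePreserving_fst_sub (m * P)).ae hy),
      ae_restrict_mem (measurableSet_Ico.prod measurableSet_Ico)] with u hu hmem
    rw [hu, invZak_apply hP G hmem.1]
  have hrem : ∀ N : ℕ, eLpNorm (fun u : ℝ × ℝ => G u -
        ∑ m ∈ Finset.Icc (-(N : ℤ)) N, y (u.1 - m * P) * tone (m * P) u.2)
      2 (volume.restrict (zakDomain P)) ^ 2 = (ENNReal.ofReal P)⁻¹ *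
        ∑' m : {m // m ∉ Finset.Icc (-(N : ℤ)) N},
          ∫⁻ t in Set.Ico 0 P, ‖fiberCoeff P (fun f => G (t, f)) m‖ₑ ^ 2 := fun N => by
    rw [eLpNorm_two_sq, ← lintegral_zak_remainder hP hG hG2]
    refine lintegral_congr_ae ?_
    filter_upwards [hcoeff] with u hu
    simp only [hu]
  have hsum := tsum_lintegral_fiberCoeff hP hG hG2 ▸ (mul_lintegral_zakDomain_lt_top hG2).ne
  have htail := (ENNReal.tendsto_tsum_compl_atTop_zero hsum).comp
    (Finset.tendsto_Icc_neg_atTop_atTop (α := ℤ) |>.comp tendsto_natCast_atTop_atTop)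
  have hsq := ENNReal.Tendsto.const_mul htail
    (Or.inr (ENNReal.inv_ne_top.2 (ENNReal.ofReal_pos.2 hP).ne'))
  rw [mul_zero] at hsq
  refine ⟨hG2, ENNReal.tendsto_nhds_zero.2 fun ε hε => ?_⟩
  filter_upwards [ENNReal.tendsto_nhds_zero.1 hsq (ε ^ 2) (ENNReal.pow_pos hε 2)] with N hN
  rw [← ENNReal.pow_le_pow_left_iff two_ne_zero, hrem]
  exact hN

theorem exists_isZakTransform {P : ℝ} (hP : 0 < P) {G : ℝ × ℝ → ℂ} (hG : Measurable G)
    (hG2 : MemLp G 2 (volume.restrict (zakDomain P))) :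
    ∃ y : Lp ℂ 2 (volume : Measure ℝ), y =ᵐ[volume] invZak P G ∧ IsZakTransform P y G ∧
      ‖y‖ₑ ^ 2 = ENNReal.ofReal P * ∫⁻ u in zakDomain P, ‖G u‖ₑ ^ 2 := by
  have hy := memLp_invZak hP hG hG2
  refine ⟨hy.toLp, hy.coeFn_toLp, isZakTransform_of_ae_eq_invZak hP hG hG2 hy.coeFn_toLp, ?_⟩
  rw [Lp.enorm_toLp, eLpNorm_two_sq, lintegral_invZak hP hG hG2]

theorem aestronglyMeasurable_zakSum (P : ℝ) (y : Lp ℂ 2 (volume : Measure ℝ)) (s : Finset ℤ) :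
    AEStronglyMeasurable (fun u : ℝ × ℝ => ∑ m ∈ s, y (u.1 - m * P) * tone (m * P) u.2) :=
  Finset.aestronglyMeasurable_fun_sum _ fun _ _ =>
    ((Lp.aestronglyMeasurable y).comp_quasiMeasurePreserving
      (quasiMeasurePreserving_fst_sub _)).mul
      ((continuous_tone _).comp continuous_snd).aestronglyMeasurable

theorem IsZakTransform.ae_eq {P : ℝ} {y : Lp ℂ 2 (volume : Measure ℝ)} {ζ ξ : ℝ × ℝ → ℂ}
    (hζ : IsZakTransform P y ζ) (hξ : IsZakTransform P y ξ) :
    ζ =ᵐ[volume.restrict (zakDomain P)] ξ := by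
  have hlimit := hζ.2.add hξ.2
  rw [add_zero] at hlimit
  have hle := ge_of_tendsto' hlimit fun N => by
    have hsum := (aestronglyMeasurable_zakSum P y (Finset.Icc (-(N : ℤ)) N)).restrict
      (s := zakDomain P)
    have := eLpNorm_sub_le (p := 2) (hζ.1.aestronglyMeasurable.sub hsum)
      (hξ.1.aestronglyMeasurable.sub hsum) one_le_two
    rwa [sub_sub_sub_cancel_right] at this
  have hzero := (eLpNorm_eq_zero_iff (hζ.1.aestronglyMeasurable.sub hξ.1.aestronglyMeasurable)
    two_ne_zero).1 (nonpos_iff_eq_zero.1 hle)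
  filter_upwards [hzero] with u hu using sub_eq_zero.1 hu

/-! ### Responses -/

theorem integrable_lp_mul_schwartz (y : Lp ℂ 2 (volume : Measure ℝ)) (φ : 𝓢(ℝ, ℂ)) :
    Integrable fun t => y t * φ t :=
  (Lp.memLp y).integrable_mul (φ.memLp 2)

theorem IsResponse.sub {H₁ H₂ : Op} {x : 𝓢'(ℝ, ℂ)} {y₁ y₂ : Lp ℂ 2 (volume : Measure ℝ)}
    (h₁ : IsResponse H₁ x y₁) (h₂ : IsResponse H₂ x y₂) :
    IsResponse (H₁ - H₂) x (y₁ - y₂) := by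
  intro φ
  have hpair : (fun p : ℝ × ℝ => (H₁ - H₂ : Op) p * modulation p.2 (translation p.1 x) φ)
      =ᵐ[volume] fun p => H₁ p * modulation p.2 (translation p.1 x) φ -
        H₂ p * modulation p.2 (translation p.1 x) φ := by
    filter_upwards [Lp.coeFn_sub H₁ H₂] with p hp
    rw [hp, Pi.sub_apply, sub_mul]
  have hresp : (fun t => (y₁ - y₂ : Lp ℂ 2 (volume : Measure ℝ)) t * φ t)
      =ᵐ[volume] fun t => y₁ t * φ t - y₂ t * φ t := by
    filter_upwards [Lp.coeFn_sub y₁ y₂] with t ht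
    rw [ht, Pi.sub_apply, sub_mul]
  refine ⟨((h₁ φ).1.sub (h₂ φ).1).congr hpair.symm, ?_⟩
  rw [integral_congr_ae hpair, integral_congr_ae hresp, integral_sub (h₁ φ).1 (h₂ φ).1,
    integral_sub (integrable_lp_mul_schwartz y₁ φ) (integrable_lp_mul_schwartz y₂ φ),
    (h₁ φ).2, (h₂ φ).2]

theorem IsResponse.eq_zero {x : 𝓢'(ℝ, ℂ)} {y : Lp ℂ 2 (volume : Measure ℝ)}
    (h : IsResponse 0 x y) : y = 0 := by
  rw [Lp.eq_zero_iff_ae_eq_zero]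
  refine ae_eq_zero_of_integral_contDiff_smul_eq_zero
    ((Lp.memLp y).locallyIntegrable one_le_two) fun g hg hsupp => ?_
  have hsuppC : HasCompactSupport fun t => (g t : ℂ) :=
    hsupp.comp_left (g := fun r : ℝ => (r : ℂ)) rfl
  have hgC : ContDiff ℝ (⊤ : ℕ∞) fun t => (g t : ℂ) := Complex.ofRealCLM.contDiff.comp hg
  have hzero : (fun p : ℝ × ℝ => (0 : Op) p *
      modulation p.2 (translation p.1 x) (hsuppC.toSchwartzMap hgC)) =ᵐ[volume] 0 := by
    filter_upwards [Lp.coeFn_zero ℂ 2 (volume : Measure (ℝ × ℝ))] with p hp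
    rw [hp, Pi.zero_apply, zero_mul]
  rw [← (integral_eq_zero_of_ae hzero), ← (h (hsuppC.toSchwartzMap hgC)).2]
  exact integral_congr_ae (ae_of_all _ fun t => by simp [mul_comm])

theorem IsResponse.unique {H : Op} {x : 𝓢'(ℝ, ℂ)} {y₁ y₂ : Lp ℂ 2 (volume : Measure ℝ)}
    (h₁ : IsResponse H x y₁) (h₂ : IsResponse H x y₂) : y₁ = y₂ := by
  have h := h₁.sub h₂
  rw [sub_self] at h
  exact sub_eq_zero.1 h.eq_zero

/-- The pairing `⟨M_ν T_τ x, φ⟩`, at the point `(τ, ν)`, of a time-frequency shift of the Dirac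
train with a test function. -/
abbrev trainPairing (T : ℝ) {L : ℕ} (c : ZMod L → ℂ) (φ : 𝓢(ℝ, ℂ)) (p : ℝ × ℝ) : ℂ :=
  modulation p.2 (translation p.1 (diracTrain T c)) φ

theorem hasSum_trainPairing (hT : 0 < T) [NeZero L] (c : ZMod L → ℂ) (φ : 𝓢(ℝ, ℂ)) (p : ℝ × ℝ) :
    HasSum (fun k : ℤ => c (k : ZMod L) * (tone p.2 (p.1 - k * T) * φ (p.1 - k * T)))
      (trainPairing T c φ p) := by
  rw [trainPairing, modulation_translation_apply]
  refine (diracTrain_apply hT c _).congr_fun fun k => ?_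
  rw [SchwartzMap.compSubConstCLM_apply,
    SchwartzMap.smulLeftCLM_apply_apply (tone_hasTemperateGrowth _), smul_eq_mul, sub_neg_eq_add,
    neg_add_eq_sub]

theorem stronglyMeasurable_trainPairing (hT : 0 < T) [NeZero L] (c : ZMod L → ℂ) (φ : 𝓢(ℝ, ℂ)) :
    StronglyMeasurable (trainPairing T c φ) := by
  refine stronglyMeasurable_of_tendsto (atTop : Filter (Finset ℤ))
    (f := fun (s : Finset ℤ) (p : ℝ × ℝ) =>
      ∑ k ∈ s, c (k : ZMod L) * (tone p.2 (p.1 - k * T) * φ (p.1 - k * T)))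
    (fun s => Continuous.stronglyMeasurable ?_)
    (tendsto_pi_nhds.2 fun p => hasSum_trainPairing hT c φ p)
  refine continuous_finsetSum _ fun k _ => continuous_const.mul (Continuous.mul ?_ ?_)
  · exact continuous_tone_uncurry.comp
      (by fun_prop : Continuous fun p : ℝ × ℝ => (p.2, p.1 - (k : ℝ) * T))
  · exact φ.continuous.comp (by fun_prop)

theorem one_add_abs_le_mul_one_add_abs_add {t s : ℝ} (ht : t ∈ Set.Ico 0 T) :
    1 + |s| ≤ (1 + T) * (1 + |t + s|) := by
  have hdist := abs_sub (t + s) t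
  rw [add_sub_cancel_left, abs_of_nonneg ht.1] at hdist
  nlinarith [abs_nonneg (t + s), ht.1, ht.2]

theorem exists_sq_mul_norm_le (φ : 𝓢(ℝ, ℂ)) : ∃ C : ℝ, ∀ x : ℝ, (1 + |x|) ^ 2 * ‖φ x‖ ≤ C :=
  ⟨_, fun x => by
    simpa only [norm_iteratedFDeriv_zero, Real.norm_eq_abs] using
      SchwartzMap.one_add_le_sup_seminorm_apply (𝕜 := ℂ) (m := (2, 0)) (k := 2) (n := 0)
        le_rfl le_rfl φ x⟩

theorem exists_summable_norm_translate_le (hT : 0 < T) (φ : 𝓢(ℝ, ℂ)) :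
    ∃ b : ℤ → ℝ, Summable b ∧ ∀ n : ℤ, ∀ t ∈ Set.Ico 0 T, ‖φ (t + n * T)‖ ≤ b n := by
  obtain ⟨C, hC⟩ := exists_sq_mul_norm_le φ
  refine ⟨fun n => ((1 + |(n : ℝ) * T|) ^ 2)⁻¹ * ((1 + T) ^ 2 * C),
    (summable_train hT).mul_right _, fun n t ht => ?_⟩
  beta_reduce
  rw [← div_eq_inv_mul, le_div_iff₀' (by positivity)]
  calc (1 + |(n : ℝ) * T|) ^ 2 * ‖φ (t + n * T)‖
      ≤ ((1 + T) * (1 + |t + n * T|)) ^ 2 * ‖φ (t + n * T)‖ := by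
        gcongr
        exact one_add_abs_le_mul_one_add_abs_add ht
    _ = (1 + T) ^ 2 * ((1 + |t + n * T|) ^ 2 * ‖φ (t + n * T)‖) := by ring
    _ ≤ (1 + T) ^ 2 * C := by gcongr; exact hC _

/-- The summand of `⟨H x, φ⟩` that comes from the cell `i` and from the impulse of the Dirac train
which this cell delays into the period `[nT, (n+1)T)`; the point of the cell is `u`. -/
def contribution (T : ℝ) {L : ℕ} (c : ZMod L → ℂ) (H : Op) (φ : 𝓢(ℝ, ℂ)) (n : ℤ)
    (i : Fin L × Fin L) (u : ℝ × ℝ) : ℂ :=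
  c (((i.1 : ℕ) : ZMod L) - (n : ZMod L)) * cellComponent T L H i u *
    tone (u.2 + (corner T L i).2) (n * T) * φ (u.1 + n * T)

theorem hasSum_contribution (hT : 0 < T) [NeZero L] (c : ZMod L → ℂ) (H : Op) (φ : 𝓢(ℝ, ℂ))
    (i : Fin L × Fin L) (u : ℝ × ℝ) :
    HasSum (fun n => contribution T c H φ n i u)
      (H (u + corner T L i) * trainPairing T c φ (u + corner T L i)) := by
  have h := (hasSum_trainPairing hT c φ (u + corner T L i)).mul_left (H (u + corner T L i))
  rw [← (Equiv.subLeft ((i.1 : ℕ) : ℤ)).hasSum_iff] at h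
  refine h.congr_fun fun n => ?_
  have htime : (u + corner T L i).1 - ((((i.1 : ℕ) : ℤ) - n : ℤ) : ℝ) * T = u.1 + n * T := by
    simp only [corner, Prod.fst_add]
    push_cast
    ring
  simp only [Function.comp_apply, Equiv.subLeft_apply, contribution, cellComponent_eq]
  rw [htime, Prod.snd_add, tone_apply_add]
  push_cast
  ring

theorem exists_summable_norm_contribution_le (hT : 0 < T) [NeZero L] (c : ZMod L → ℂ)
    (φ : 𝓢(ℝ, ℂ)) :
    ∃ b : ℤ → ℝ, Summable b ∧ ∀ (H : Op) (n : ℤ) (i : Fin L × Fin L), ∀ u ∈ cell T L,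
      ‖contribution T c H φ n i u‖ ≤ b n * ‖cellComponent T L H i u‖ := by
  obtain ⟨b, hsum, hb⟩ := exists_summable_norm_translate_le hT φ
  refine ⟨fun n => b n * ∑ j, ‖c j‖, hsum.mul_right _, fun H n i u hu => ?_⟩
  have hcoeff : ‖c (((i.1 : ℕ) : ZMod L) - (n : ZMod L))‖ ≤ ∑ j, ‖c j‖ :=
    Finset.single_le_sum (f := fun j => ‖c j‖) (fun _ _ => norm_nonneg _) (Finset.mem_univ _)
  have hφ := hb n u.1 hu.1
  have hbn := (norm_nonneg _).trans hφ
  rw [contribution, norm_mul, norm_mul, norm_mul, norm_tone, mul_one, mul_comm, mul_assoc]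
  gcongr

theorem integrableOn_cellComponent (H : Op) (i : Fin L × Fin L) :
    IntegrableOn (cellComponent T L H i) (cell T L) := by
  have : IsFiniteMeasure (volume.restrict (cell T L)) :=
    isFiniteMeasure_restrict.2 volume_cell_lt_top.ne
  exact (memLp_cellComponent H i).integrable one_le_two

theorem stronglyMeasurable_contribution (c : ZMod L → ℂ) (H : Op) (φ : 𝓢(ℝ, ℂ)) (n : ℤ)
    (i : Fin L × Fin L) : StronglyMeasurable (contribution T c H φ n i) := by
  refine (((stronglyMeasurable_cellComponent H i).const_mul _).mul
    (Continuous.stronglyMeasurable ?_)).mul (Continuous.stronglyMeasurable ?_)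
  · exact continuous_tone_uncurry.comp (by fun_prop : Continuous fun u : ℝ × ℝ =>
      (u.2 + (corner T L i).2, (n : ℝ) * T))
  · exact φ.continuous.comp (by fun_prop)

theorem integrableOn_contribution (hT : 0 < T) [NeZero L] (c : ZMod L → ℂ) (H : Op)
    (φ : 𝓢(ℝ, ℂ)) (n : ℤ) (i : Fin L × Fin L) :
    IntegrableOn (contribution T c H φ n i) (cell T L) := by
  obtain ⟨b, -, hb⟩ := exists_summable_norm_contribution_le hT c φ
  refine ((integrableOn_cellComponent H i).norm.const_mul (b n)).mono'
    (stronglyMeasurable_contribution c H φ n i).aestronglyMeasurable ?_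
  filter_upwards [ae_restrict_mem measurableSet_cell] with u hu using hb H n i u hu

theorem integrableOn_mul_trainPairing (hT : 0 < T) [NeZero L] (c : ZMod L → ℂ) (H : Op)
    (φ : 𝓢(ℝ, ℂ)) (i : Fin L × Fin L) :
    IntegrableOn (fun p => H p * trainPairing T c φ p) (corner T L i +ᵥ cell T L) := by
  obtain ⟨b, hsum, hb⟩ := exists_summable_norm_contribution_le hT c φ
  refine ((measurePreserving_add_corner i).integrable_comp_emb
    (measurableEmbedding_addRight _)).1 ?_
  refine ((integrableOn_cellComponent H i).norm.const_mul (∑' n, b n)).mono' ?_ ?_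
  · exact (((Lp.stronglyMeasurable H).mul (stronglyMeasurable_trainPairing hT c φ)).comp_measurable
      (measurable_add_const _)).aestronglyMeasurable
  · filter_upwards [ae_restrict_mem measurableSet_cell] with u hu
    rw [← tsum_mul_right, Function.comp_apply, ← (hasSum_contribution hT c H φ i u).tsum_eq]
    exact tsum_of_norm_bounded (hsum.mul_right _).hasSum fun n => hb H n i u hu

theorem hasSum_integral_contribution (hT : 0 < T) [NeZero L] (c : ZMod L → ℂ) (H : Op)
    (φ : 𝓢(ℝ, ℂ)) (i : Fin L × Fin L) :
    HasSum (fun n => ∫ u in cell T L, contribution T c H φ n i u)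
      (∫ p in corner T L i +ᵥ cell T L, H p * trainPairing T c φ p) := by
  obtain ⟨b, hsum, hb⟩ := exists_summable_norm_contribution_le hT c φ
  have hnorm : Summable fun n => ∫ u in cell T L, ‖contribution T c H φ n i u‖ := by
    refine Summable.of_nonneg_of_le (fun n => integral_nonneg fun _ => norm_nonneg _)
      (fun n => ?_) (hsum.mul_right (∫ u in cell T L, ‖cellComponent T L H i u‖))
    rw [← integral_const_mul]
    exact setIntegral_mono_on (integrableOn_contribution hT c H φ n i).norm
      ((integrableOn_cellComponent H i).norm.const_mul (b n)) measurableSet_cell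
      fun u hu => hb H n i u hu
  rw [← (measurePreserving_add_corner i).integral_comp (measurableEmbedding_addRight _)]
  simpa only [(hasSum_contribution hT c H φ i _).tsum_eq] using
    hasSum_integral_of_summable_integral_norm
      (fun n => integrableOn_contribution hT c H φ n i) hnorm

theorem integrable_mul_trainPairing (hT : 0 < T) [NeZero L] (c : ZMod L → ℂ) {H : Op}
    (hH : H ∈ opClass T L Finset.univ) (φ : 𝓢(ℝ, ℂ)) :
    Integrable fun p => H p * trainPairing T c φ p := by
  refine IntegrableOn.integrable_of_ae_notMem_eq_zero (s := region T L Finset.univ) ?_ ?_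
  · rw [region, integrableOn_finset_iUnion]
    exact fun i _ => integrableOn_mul_trainPairing hT c H φ i
  · filter_upwards [mem_opClass_iff.1 hH] with p hp hreg
    rw [hp hreg, zero_mul]

theorem hasSum_sum_integral_contribution (hT : 0 < T) [NeZero L] (c : ZMod L → ℂ) {H : Op}
    (hH : H ∈ opClass T L Finset.univ) (φ : 𝓢(ℝ, ℂ)) :
    HasSum (fun n => ∫ u in cell T L, ∑ i, contribution T c H φ n i u)
      (∫ p, H p * trainPairing T c φ p) := by
  have hsupp : ∀ᵐ p : ℝ × ℝ, p ∉ region T L Finset.univ → H p * trainPairing T c φ p = 0 := by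
    filter_upwards [mem_opClass_iff.1 hH] with p hp hreg
    rw [hp hreg, zero_mul]
  have hunion : region T L Finset.univ = ⋃ i ∈ Finset.univ, corner T L i +ᵥ cell T L := rfl
  rw [← setIntegral_eq_integral_of_ae_compl_eq_zero hsupp, hunion,
    integral_biUnion_finset _ (fun _ _ => measurableSet_cell_vadd _) (pairwiseDisjoint_cells _)
      fun i _ => integrableOn_mul_trainPairing hT c H φ i]
  refine (hasSum_sum fun i _ => hasSum_integral_contribution hT c H φ i).congr_fun fun n => ?_
  exact integral_finsetSum _ fun i _ => integrableOn_contribution hT c H φ n i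

/-! ### The Zak transform of the response -/

/-- The map `H ↦ A_c s`, where `s` is the vector of the components of `H`. Up to the factor `√(TL)`
its values have the norm of the response, because of the choice of the `ℓ²` norm on `L²(U)ᴸ`. -/
def zakMap (T : ℝ) {L : ℕ} (c : ZMod L → ℂ) : Op →L[ℂ] PiLp 2 fun _ : Fin L => CellL2 T L :=
  (PiLp.continuousLinearEquiv 2 ℂ _).symm.toContinuousLinearMap ∘L
    ContinuousLinearMap.pi fun p => ∑ i, trainMatrix T c p i • cellMap T L i

theorem zakMap_apply (c : ZMod L → ℂ) (H : Op) (p : Fin L) :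
    zakMap T c H p = ∑ i, trainMatrix T c p i • cellMap T L i H := by
  simp [zakMap]

theorem coeFn_zakMap (c : ZMod L → ℂ) (H : Op) (p : Fin L) :
    zakMap T c H p =ᵐ[volume.restrict (cell T L)]
      fun u => (trainMatrix T c *ᵥ fun i => cellComponent T L H i u) p := by
  rw [zakMap_apply]
  exact coeFn_sum_smul_cellMap Finset.univ (trainMatrix T c p) H

/-- The function on `[0, TL) × [0, 1/(TL))` with Zak vector `A_c s`; it is the Zak transform of the
response of `H` to the Dirac train. -/
def responseZak (T : ℝ) {L : ℕ} (c : ZMod L → ℂ) (H : Op) (u : ℝ × ℝ) : ℂ :=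
  ∑ p : Fin L, (Set.Ico 0 T).indicator (fun t =>
    (trainMatrix T c *ᵥ fun i => cellComponent T L H i (t, u.2)) p * tone (p * T) u.2)
      (u.1 - p * T)

theorem responseZak_apply (c : ZMod L → ℂ) (H : Op) (p : Fin L) {t : ℝ} (ht : t ∈ Set.Ico 0 T)
    (f : ℝ) : responseZak T c H (t + p * T, f) =
      (trainMatrix T c *ᵥ fun i => cellComponent T L H i (t, f)) p * tone (p * T) f := by
  rw [responseZak, Finset.sum_eq_single_of_mem p (Finset.mem_univ p)]
  · rw [add_sub_cancel_right, Set.indicator_of_mem ht]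
  · exact fun q _ hqp => Set.indicator_of_notMem (fun hmem => hqp (Fin.ext
      (natCast_eq_of_add_mul_mem_Ico hmem ht (sub_add_cancel _ _)))) _

theorem measurable_responseZak (c : ZMod L → ℂ) (H : Op) : Measurable (responseZak T c H) := by
  have hrow : ∀ p : Fin L, Measurable fun u : ℝ × ℝ =>
      (trainMatrix T c *ᵥ fun i => cellComponent T L H i u) p * tone (p * T) u.2 := fun p =>
    (Finset.measurable_fun_sum _ fun i _ =>
      (stronglyMeasurable_cellComponent H i).measurable.const_mul _).mul
      ((continuous_tone _).measurable.comp measurable_snd)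
  refine Finset.measurable_fun_sum _ fun p _ => ?_
  exact ((hrow p).indicator (measurableSet_Ico.preimage measurable_fst)).comp
    (by fun_prop : Measurable fun u : ℝ × ℝ => (u.1 - p * T, u.2))

theorem measurePreserving_add_row (T : ℝ) (s : Set ℝ) (p : ℕ) :
    MeasurePreserving (fun u : ℝ × ℝ => (u.1 + p * T, u.2))
      (volume.restrict (Set.Ico 0 T ×ˢ s))
      (volume.restrict (Set.Ico (T * p) (T * (p + 1)) ×ˢ s)) := by
  have h := (measurePreserving_add_mul_Ico T p).prod
    (MeasurePreserving.id (volume.restrict s : Measure ℝ))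
  rw [Measure.prod_restrict, Measure.prod_restrict, ← Measure.volume_eq_prod] at h
  simpa [mul_comm T, Prod.map_def] using h

theorem lintegral_Ico_mul_natCast_prod (hT : 0 ≤ T) {s : Set ℝ} (hs : MeasurableSet s)
    (F : ℝ × ℝ → ℝ≥0∞) (N : ℕ) :
    ∫⁻ u in Set.Ico 0 (T * N) ×ˢ s, F u =
      ∑ p ∈ Finset.range N, ∫⁻ u in Set.Ico 0 T ×ˢ s, F (u.1 + p * T, u.2) := by
  induction N with
  | zero => simp
  | succ N ih =>
    have hemb : MeasurableEmbedding fun u : ℝ × ℝ => (u.1 + N * T, u.2) := by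
      convert measurableEmbedding_addRight ((N : ℝ) * T, (0 : ℝ)) using 2 with u
      ext <;> simp
    have hsplit : Set.Ico 0 (T * (N + 1 : ℕ)) ×ˢ s =
        Set.Ico 0 (T * N) ×ˢ s ∪ Set.Ico (T * N) (T * (N + 1)) ×ˢ s := by
      rw [← Set.union_prod, Nat.cast_succ, Set.Ico_union_Ico_eq_Ico (by positivity)]
      gcongr
      linarith
    rw [hsplit, lintegral_union (measurableSet_Ico.prod hs), ih, Finset.sum_range_succ,
      (measurePreserving_add_row T s N).lintegral_comp_emb hemb]
    exact Set.Disjoint.set_prod_left Set.Ico_disjoint_Ico_same _ _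

theorem lintegral_responseZak (hT : 0 < T) (c : ZMod L → ℂ) (H : Op) :
    ∫⁻ u in zakDomain (T * L), ‖responseZak T c H u‖ₑ ^ 2 = ∑ p, ‖zakMap T c H p‖ₑ ^ 2 := by
  rw [lintegral_Ico_mul_natCast_prod hT.le measurableSet_Ico, Finset.sum_range]
  refine Finset.sum_congr rfl fun p _ => ?_
  rw [enorm_lp_sq]
  refine lintegral_congr_ae ?_
  filter_upwards [coeFn_zakMap c H p, ae_restrict_mem measurableSet_cell] with u hcoe hu
  rw [hcoe, responseZak_apply c H p hu.1, enorm_mul, enorm_tone, mul_one]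

theorem memLp_responseZak (hT : 0 < T) (c : ZMod L → ℂ) (H : Op) :
    MemLp (responseZak T c H) 2 (volume.restrict (zakDomain (T * L))) := by
  refine memLp_two_of_lintegral_lt_top (measurable_responseZak c H).aestronglyMeasurable ?_
  rw [lintegral_responseZak hT]
  exact ENNReal.sum_lt_top.2 fun p _ => by simp

theorem tone_div_mul_add (hT : T ≠ 0) [NeZero L] (m p : ℕ) (r : ℤ) :
    tone ((m : ℝ) / (T * L)) (((r * L + p : ℤ) : ℝ) * T) =
      Complex.exp (2 * Real.pi * Complex.I * p * m / L) := by
  have hL : (L : ℂ) ≠ 0 := NeZero.ne _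
  have hTC : (T : ℂ) ≠ 0 := by exact_mod_cast hT
  rw [tone, Complex.exp_eq_exp_iff_exists_int]
  refine ⟨m * r, ?_⟩
  push_cast
  field_simp
  ring

theorem contribution_mul_add (hT : T ≠ 0) [NeZero L] (c : ZMod L → ℂ) (H : Op) (φ : 𝓢(ℝ, ℂ))
    (r : ℤ) (p : Fin L) (i : Fin L × Fin L) (u : ℝ × ℝ) :
    contribution T c H φ (r * L + p) i u =
      (T * L : ℝ) * (trainMatrix T c p i * cellComponent T L H i u * tone (p * T) u.2 *
        tone (r * (T * L)) u.2) * φ (u.1 + ((r * L + p : ℤ) : ℝ) * T) := by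
  have hTL : ((T * L : ℝ) : ℂ) * (1 / (T * L)) = 1 := by
    push_cast
    exact mul_one_div_cancel (mul_ne_zero (by exact_mod_cast hT) (NeZero.ne _))
  have htone : tone (u.2 + (corner T L i).2) (((r * L + p : ℤ) : ℝ) * T) =
      tone (p * T) u.2 * tone (r * (T * L)) u.2 *
        Complex.exp (2 * Real.pi * Complex.I * (p : ℕ) * (i.2 : ℕ) / L) := by
    rw [← tone_div_mul_add hT, tone_add, tone_comm u.2, ← tone_add]
    congr 2
    push_cast
    ring
  have hindex : (((r * L + p : ℤ) : ZMod L)) = ((p : ℕ) : ZMod L) := by simp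
  simp only [contribution, trainMatrix, Matrix.of_apply]
  rw [htone, hindex]
  linear_combination (-(c (((i.1 : ℕ) : ZMod L) - ((p : ℕ) : ZMod L)) *
    cellComponent T L H i u * tone (p * T) u.2 * tone (r * (T * L)) u.2 *
    Complex.exp (2 * Real.pi * Complex.I * (p : ℕ) * (i.2 : ℕ) / L) *
    φ (u.1 + ((r * L + p : ℤ) : ℝ) * T))) * hTL

theorem add_natCast_mul_mem_Ico {t : ℝ} (ht : t ∈ Set.Ico 0 T) (p : Fin L) :
    t + p * T ∈ Set.Ico 0 (T * L) := by
  have hT : 0 < T := ht.1.trans_lt ht.2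
  have hpL : (p : ℝ) + 1 ≤ L := by exact_mod_cast p.2
  exact ⟨add_nonneg ht.1 (by positivity), by nlinarith [ht.2]⟩

theorem invZak_responseZak_mul (hT : 0 < T) [NeZero L] (c : ZMod L → ℂ) (H : Op) (φ : 𝓢(ℝ, ℂ))
    (n : ℤ) {t : ℝ} (ht : t ∈ Set.Ico 0 T) :
    invZak (T * L) (responseZak T c H) (t + n * T) * φ (t + n * T) =
      ∫ f in Set.Ico 0 (1 / (T * L)), ∑ i, contribution T c H φ n i (t, f) := by
  obtain ⟨⟨r, p⟩, rfl⟩ := (Int.divModEquiv L).symm.surjective n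
  have hTL : 0 < T * L := mul_pos hT (Nat.cast_pos.2 (NeZero.pos L))
  have htime : t + ((r * L + p : ℤ) : ℝ) * T = t + p * T - ((-r : ℤ) : ℝ) * (T * L) := by
    push_cast
    ring
  simp only [Int.divModEquiv_symm_apply, contribution_mul_add hT.ne']
  rw [htime, invZak_apply hTL _ (add_natCast_mul_mem_Ico ht p), fiberCoeff,
    ← integral_const_mul, ← integral_mul_const]
  refine integral_congr_ae (ae_of_all _ fun f => ?_)
  simp only [responseZak_apply c H p ht, Matrix.mulVec, dotProduct, Finset.sum_mul,
    Finset.mul_sum, Int.cast_neg, neg_mul, neg_neg]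

theorem isResponse_of_ae_eq_invZak (hT : 0 < T) [NeZero L] (c : ZMod L → ℂ) {H : Op}
    (hH : H ∈ opClass T L Finset.univ) {y : Lp ℂ 2 (volume : Measure ℝ)}
    (hy : y =ᵐ[volume] invZak (T * L) (responseZak T c H)) :
    IsResponse H (diracTrain T c) y := by
  refine fun φ => ⟨integrable_mul_trainPairing hT c hH φ, ?_⟩
  refine (hasSum_integral_translates hT (integrable_lp_mul_schwartz y φ)).unique
    ((hasSum_sum_integral_contribution hT c hH φ).congr_fun fun n => ?_)
  rw [cell, Measure.volume_eq_prod, setIntegral_prod]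
  · refine setIntegral_congr_ae measurableSet_Ico ?_
    filter_upwards [(measurePreserving_add_right (volume : Measure ℝ)
      (n * T)).quasiMeasurePreserving.ae hy] with t hyt ht
    rw [hyt, invZak_responseZak_mul hT c H φ n ht]
  · exact integrable_finsetSum _ fun i _ => integrableOn_contribution hT c H φ n i

theorem exists_isResponse (hT : 0 < T) [NeZero L] (c : ZMod L → ℂ) {H : Op}
    (hH : H ∈ opClass T L Finset.univ) :
    ∃ y : Lp ℂ 2 (volume : Measure ℝ), IsResponse H (diracTrain T c) y ∧
      IsZakTransform (T * L) y (responseZak T c H) ∧ ‖y‖ = √(T * L) * ‖zakMap T c H‖ := by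
  have hTL : 0 < T * L := mul_pos hT (Nat.cast_pos.2 (NeZero.pos L))
  obtain ⟨y, hy, hzak, hnorm⟩ :=
    exists_isZakTransform hTL (measurable_responseZak c H) (memLp_responseZak hT c H)
  refine ⟨y, isResponse_of_ae_eq_invZak hT c hH hy, hzak, ?_⟩
  rw [lintegral_responseZak hT] at hnorm
  have hsq := congrArg ENNReal.toReal hnorm
  rw [ENNReal.toReal_mul, ENNReal.toReal_sum fun i _ => by simp,
    ENNReal.toReal_ofReal hTL.le] at hsq
  simp only [ENNReal.toReal_pow, toReal_enorm, ← PiLp.norm_sq_eq_of_L2] at hsq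
  rw [← Real.sqrt_sq (norm_nonneg y), hsq, Real.sqrt_mul hTL.le, Real.sqrt_sq (norm_nonneg _)]

theorem zakVector_ae_eq_mulVec (c : ZMod L → ℂ) {H : Op}
    {y : Lp ℂ 2 (volume : Measure ℝ)} (hy : IsZakTransform (T * L) y (responseZak T c H))
    {ζ : ℝ × ℝ → ℂ} (hζ : IsZakTransform (T * L) y ζ) :
    ∀ᵐ u ∂volume.restrict (cell T L),
      zakVector T L ζ u = trainMatrix T c *ᵥ fun i => cellComponent T L H i u := by
  have hae := (ae_restrict_iff' (measurableSet_Ico.prod measurableSet_Ico)).1 (hζ.ae_eq hy)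
  suffices h : ∀ᵐ u ∂volume.restrict (cell T L), ∀ p : Fin L,
      zakVector T L ζ u p = (trainMatrix T c *ᵥ fun i => cellComponent T L H i u) p from
    h.mono fun _ => funext
  refine eventually_all.2 fun p => ?_
  filter_upwards [ae_restrict_mem measurableSet_cell,
    (measurePreserving_add_row T _ p).quasiMeasurePreserving.ae (ae_restrict_of_ae hae)]
    with u hu hrow
  rw [zakVector, hrow ⟨add_natCast_mul_mem_Ico hu.1 p, hu.2⟩, responseZak_apply c H p hu.1,
    mul_assoc, ← tone_add, add_neg_cancel, tone_zero, mul_one]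

/-! ### Lower bounds for the Zak map -/

theorem exists_eqOn_vecMul {𝕜 m n : Type*} [Field 𝕜] [Fintype m] {A : Matrix m n 𝕜} {Λ : Set n}
    (hA : LinearIndepOn 𝕜 A.col Λ) (w : n → 𝕜) : ∃ v : m → 𝕜, Set.EqOn (v ᵥ* A) w Λ := by
  classical
  let b := Module.Basis.span hA
  obtain ⟨g, hg⟩ := LinearMap.exists_extend (b.constr 𝕜 fun i : Λ => w i)
  obtain ⟨v, rfl⟩ := (dotProductEquiv 𝕜 m).surjective g
  refine ⟨v, fun i hi => ?_⟩
  calc (v ᵥ* A) i = b.constr 𝕜 (fun i : Λ => w i) (b ⟨i, hi⟩) := by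
        rw [← hg, LinearMap.comp_apply, Submodule.subtype_apply, Module.Basis.span_apply hA]
        rfl
    _ = w i := b.constr_basis 𝕜 _ _

theorem HasFullSpark.exists_vecMul_eq_one {𝕜 m n : Type*} [Field 𝕜] [Fintype m]
    {A : Matrix m n 𝕜} (hA : HasFullSpark A) {Λ : Finset n} (hΛ : Λ.card < Fintype.card m)
    {j : n} (hj : j ∉ Λ) :
    ∃ v : m → 𝕜, (v ᵥ* A) j = 1 ∧ ∀ i ∈ Λ, (v ᵥ* A) i = 0 := by
  classical
  obtain ⟨v, hv⟩ := exists_eqOn_vecMul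
    (hA (insert j Λ) ((Finset.card_insert_le _ _).trans hΛ)) (Pi.single j 1)
  refine ⟨v, by simpa using hv (Finset.mem_insert_self j Λ), fun i hi => ?_⟩
  rw [hv (Finset.mem_insert_of_mem hi), Pi.single_eq_of_ne (ne_of_mem_of_not_mem hi hj)]

theorem sum_smul_zakMap (c : ZMod L → ℂ) {Γ : Finset (Fin L × Fin L)} {H : Op}
    (hH : H ∈ opClass T L Γ) (v : Fin L → ℂ) :
    ∑ p, v p • zakMap T c H p = ∑ i ∈ Γ, (v ᵥ* trainMatrix T c) i • cellMap T L i H := by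
  simp only [zakMap_apply, Finset.smul_sum, smul_smul, Matrix.vecMul, dotProduct,
    Finset.sum_smul]
  rw [Finset.sum_comm]
  refine (Finset.sum_subset (Finset.subset_univ Γ) fun i _ hi => ?_).symm
  simp [cellMap_eq_zero hH hi]

theorem norm_sum_smul_piLp_le {ι 𝕜 E : Type*} [Fintype ι] [NormedField 𝕜]
    [SeminormedAddCommGroup E] [NormedSpace 𝕜 E] {q : ℝ≥0∞} [Fact (1 ≤ q)]
    (v : ι → 𝕜) (z : PiLp q fun _ : ι => E) : ‖∑ p, v p • z p‖ ≤ (∑ p, ‖v p‖) * ‖z‖ := by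
  rw [Finset.sum_mul]
  refine norm_sum_le_of_le _ fun p _ => ?_
  rw [norm_smul]
  gcongr
  exact PiLp.norm_apply_le z p

theorem norm_le_sum_norm_cellMap {Γ : Finset (Fin L × Fin L)} {H : Op}
    (hH : H ∈ opClass T L Γ) : ‖H‖ ≤ ∑ i ∈ Γ, ‖cellMap T L i H‖ := by
  refine le_of_sq_le_sq ?_ (Finset.sum_nonneg fun i _ => norm_nonneg _)
  rw [norm_sq_eq_sum_cellMap hH]
  exact Finset.sum_sq_le_sq_sum_of_nonneg fun i _ => norm_nonneg _

theorem exists_norm_le_zakMap {c : ZMod L → ℂ} {Γ : Finset (Fin L × Fin L)}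
    (hc : LinearIndepOn ℂ (trainMatrix T c).col Γ) :
    ∃ V : ℝ, 0 < V ∧ ∀ H ∈ opClass T L Γ, ‖H‖ ≤ V * ‖zakMap T c H‖ := by
  choose v hv using fun i => exists_eqOn_vecMul hc (Pi.single i 1)
  refine ⟨∑ i ∈ Γ, ∑ p, ‖v i p‖ + 1, by positivity, fun H hH => ?_⟩
  have hcell : ∀ i ∈ Γ, ‖cellMap T L i H‖ ≤ (∑ p, ‖v i p‖) * ‖zakMap T c H‖ := by
    intro i hi
    have hextract : ∑ p, v i p • zakMap T c H p = cellMap T L i H := by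
      rw [sum_smul_zakMap c hH, Finset.sum_congr rfl fun j hj => by rw [hv i hj]]
      simp [Pi.single_apply, hi]
    rw [← hextract]
    exact norm_sum_smul_piLp_le _ _
  calc ‖H‖ ≤ ∑ i ∈ Γ, ‖cellMap T L i H‖ := norm_le_sum_norm_cellMap hH
    _ ≤ (∑ i ∈ Γ, ∑ p, ‖v i p‖) * ‖zakMap T c H‖ := by
        rw [Finset.sum_mul]
        exact Finset.sum_le_sum hcell
    _ ≤ (∑ i ∈ Γ, ∑ p, ‖v i p‖ + 1) * ‖zakMap T c H‖ := by
        gcongr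
        linarith

-- A functional that annihilates the columns of `Γ'` but not a column of `Γ` sees `H` and not `H'`.
theorem exists_le_norm_zakMap_sub {c : ZMod L → ℂ} (hc : HasFullSpark (trainMatrix T c))
    {Γ Γ' : Finset (Fin L × Fin L)} (hΓ' : Γ'.card < L) (hsub : ¬Γ ⊆ Γ') {H : Op}
    (hH : H ∈ opClass T L Γ) (hind : CellsIndependent T L Γ H) :
    ∃ ε : ℝ, 0 < ε ∧ ∀ H' ∈ opClass T L Γ', ε ≤ ‖zakMap T c (H - H')‖ := by
  obtain ⟨j, hj, hj'⟩ := Finset.not_subset.1 hsub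
  obtain ⟨v, hvj, hvΓ'⟩ := hc.exists_vecMul_eq_one (by simpa using hΓ') hj'
  let e := ∑ p, v p • zakMap T c H p
  have he : 0 < ‖e‖ := by
    refine norm_pos_iff.2 fun hzero => one_ne_zero (hvj.symm.trans ?_)
    exact linearIndepOn_finset_iff.1 (cellsIndependent_iff.1 hind) _
      ((sum_smul_zakMap c hH v).symm.trans hzero) j hj
  have hkill : ∀ H' ∈ opClass T L Γ', ∑ p, v p • zakMap T c H' p = 0 := fun H' hH' => by
    rw [sum_smul_zakMap c hH']
    exact Finset.sum_eq_zero fun i hi => by rw [hvΓ' i hi, zero_smul]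
  refine ⟨‖e‖ / (∑ p, ‖v p‖ + 1), by positivity, fun H' hH' => ?_⟩
  rw [div_le_iff₀' (by positivity)]
  calc ‖e‖ = ‖∑ p, v p • zakMap T c (H - H') p‖ := by
        simp only [map_sub, PiLp.sub_apply, smul_sub, Finset.sum_sub_distrib, hkill H' hH',
          sub_zero, e]
    _ ≤ (∑ p, ‖v p‖) * ‖zakMap T c (H - H')‖ := norm_sum_smul_piLp_le _ _
    _ ≤ (∑ p, ‖v p‖ + 1) * ‖zakMap T c (H - H')‖ := by
        gcongr
        linarith

theorem exists_norm_sub_le_zakMap {c : ZMod L → ℂ} (hc : HasFullSpark (trainMatrix T c))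
    {Γ Γ' : Finset (Fin L × Fin L)} (hΓ' : Γ'.card < L) {H : Op}
    (hH : H ∈ opClass T L Γ) (hind : CellsIndependent T L Γ H) :
    ∃ W : ℝ, ∀ H' ∈ opClass T L Γ', ‖H - H'‖ ≤ W * ‖zakMap T c (H - H')‖ := by
  obtain ⟨V, hV, hlow⟩ := exists_norm_le_zakMap (hc Γ' (by simpa using hΓ'.le))
  by_cases hsub : Γ ⊆ Γ'
  · exact ⟨V, fun H' hH' => hlow _ (sub_mem (opClass_mono hsub hH) hH')⟩
  obtain ⟨ε, hε, hsep⟩ := exists_le_norm_zakMap_sub hc hΓ' hsub hH hind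
  refine ⟨(‖H‖ + V * ‖zakMap T c H‖) / ε + V, fun H' hH' => ?_⟩
  have hzak : ‖zakMap T c H'‖ ≤ ‖zakMap T c H‖ + ‖zakMap T c (H - H')‖ := by
    rw [map_sub]
    exact norm_le_norm_add_norm_sub _ _
  calc ‖H - H'‖ ≤ ‖H‖ + ‖H'‖ := norm_sub_le _ _
    _ ≤ ‖H‖ + V * (‖zakMap T c H‖ + ‖zakMap T c (H - H')‖) := by
        gcongr
        exact (hlow H' hH').trans (by gcongr)
    _ = (‖H‖ + V * ‖zakMap T c H‖) / ε * ε + V * ‖zakMap T c (H - H')‖ := by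
        field_simp
        ring
    _ ≤ (‖H‖ + V * ‖zakMap T c H‖) / ε * ‖zakMap T c (H - H')‖ +
        V * ‖zakMap T c (H - H')‖ := by
        gcongr
        exact hsep H' hH'
    _ = ((‖H‖ + V * ‖zakMap T c H‖) / ε + V) * ‖zakMap T c (H - H')‖ := by ring

/-! ### Stable identification -/

theorem mem_blindClass {Δ : ℝ} {H : Op} :
    H ∈ blindClass T L Δ ↔ ∃ Γ : Finset (Fin L × Fin L), area T L Γ ≤ Δ ∧ H ∈ opClass T L Γ := by
  simp [blindClass]

theorem StabilityBounds.mono {x : 𝓢'(ℝ, ℂ)} {α α' β : ℝ} {H₁ H₂ : Op}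
    (h : StabilityBounds x α β H₁ H₂) (hα : α' ≤ α) : StabilityBounds x α' β H₁ H₂ := by
  obtain ⟨y₁, y₂, hy₁, hy₂, hlow, hup⟩ := h
  exact ⟨y₁, y₂, hy₁, hy₂, le_trans (by gcongr) hlow, hup⟩

theorem stablyIdentifies_of_stabilityBounds {x : 𝓢'(ℝ, ℂ)} {Q : Set Op} {α β : ℝ}
    (hα : 0 < α) (hβ : 1 ≤ β) (h : ∀ H₁ ∈ Q, ∀ H₂ ∈ Q, StabilityBounds x α β H₁ H₂) :
    StablyIdentifies x Q :=
  ⟨min α 1, β, lt_min hα one_pos, (min_le_right _ _).trans hβ,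
    fun H₁ h₁ H₂ h₂ => (h H₁ h₁ H₂ h₂).mono (min_le_left _ _)⟩

theorem stablyIdentifiesIn_of_stabilityBounds {x : 𝓢'(ℝ, ℂ)} {Q : Set Op} {H : Op} {α β : ℝ}
    (hα : 0 < α) (hβ : 1 ≤ β) (h : ∀ H' ∈ Q, StabilityBounds x α β H H') :
    StablyIdentifiesIn x Q H :=
  ⟨min α 1, β, lt_min hα one_pos, (min_le_right _ _).trans hβ,
    fun H' hH' => (h H' hH').mono (min_le_left _ _)⟩

/-- A Lipschitz constant of the map `H ↦ H x` for the Dirac train `x`, taken to be at least `1` so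
that it dominates lower stability bounds capped at `1`. -/
def upperBound (T : ℝ) {L : ℕ} (c : ZMod L → ℂ) : ℝ := max 1 (√(T * L) * ‖zakMap T c‖)

theorem one_le_upperBound (T : ℝ) {L : ℕ} (c : ZMod L → ℂ) : 1 ≤ upperBound T c :=
  le_max_left _ _

theorem stabilityBounds_of_norm_le (hT : 0 < T) [NeZero L] (c : ZMod L → ℂ)
    {Γ₁ Γ₂ : Finset (Fin L × Fin L)} {H₁ H₂ : Op} (h₁ : H₁ ∈ opClass T L Γ₁)
    (h₂ : H₂ ∈ opClass T L Γ₂) {W : ℝ} (hW : 0 < W)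
    (h : ‖H₁ - H₂‖ ≤ W * ‖zakMap T c (H₁ - H₂)‖) :
    StabilityBounds (diracTrain T c) (√(T * L) / W) (upperBound T c) H₁ H₂ := by
  have h₁ := opClass_mono (Finset.subset_univ _) h₁
  have h₂ := opClass_mono (Finset.subset_univ _) h₂
  obtain ⟨y₁, hy₁, -, -⟩ := exists_isResponse hT c h₁
  obtain ⟨y₂, hy₂, -, -⟩ := exists_isResponse hT c h₂
  obtain ⟨y, hy, -, hnorm⟩ := exists_isResponse hT c (sub_mem h₁ h₂)
  rw [hy.unique (hy₁.sub hy₂)] at hnorm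
  refine ⟨y₁, y₂, hy₁, hy₂, ?_, ?_⟩
  · rw [hnorm, div_mul_eq_mul_div, mul_div_assoc]
    gcongr
    rwa [div_le_iff₀' hW]
  · calc ‖y₁ - y₂‖ = √(T * L) * ‖zakMap T c (H₁ - H₂)‖ := hnorm
      _ ≤ √(T * L) * (‖zakMap T c‖ * ‖H₁ - H₂‖) := by
          gcongr
          exact (zakMap T c).le_opNorm _
      _ = √(T * L) * ‖zakMap T c‖ * ‖H₁ - H₂‖ := (mul_assoc _ _ _).symm
      _ ≤ upperBound T c * ‖H₁ - H₂‖ := by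
          gcongr
          exact le_max_right _ _

theorem exists_stabilityBounds (hT : 0 < T) [NeZero L] {Δ : ℝ} (hΔ : Δ < 1) {c : ZMod L → ℂ}
    (hc : HasFullSpark (trainMatrix T c)) {Γ : Finset (Fin L × Fin L)} {H : Op}
    (hH : H ∈ opClass T L Γ) (hind : CellsIndependent T L Γ H) :
    ∃ α : ℝ, 0 < α ∧ ∀ H' ∈ blindClass T L Δ,
      StabilityBounds (diracTrain T c) α (upperBound T c) H H' := by
  have hL : (0 : ℝ) < L := Nat.cast_pos.2 (NeZero.pos L)
  choose! W hW using fun (Γ' : Finset (Fin L × Fin L)) (hΓ' : area T L Γ' ≤ Δ) =>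
    exists_norm_sub_le_zakMap hc (card_lt_of_area_lt_one hT (hΓ'.trans_lt hΔ)) hH hind
  obtain ⟨M, hM⟩ := Finite.exists_le W
  refine ⟨√(T * L) / max M 1, by positivity, fun H' hH' => ?_⟩
  obtain ⟨Γ', hΓ', hH'⟩ := mem_blindClass.1 hH'
  refine stabilityBounds_of_norm_le hT c hH hH' (by positivity) ((hW Γ' hΓ' H' hH').trans ?_)
  gcongr
  exact (hM Γ').trans (le_max_left _ _)

theorem stablyIdentifiesIn_of_cellsIndependent (hT : 0 < T) [NeZero L] {Δ : ℝ} (hΔ : Δ < 1)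
    {c : ZMod L → ℂ} (hc : HasFullSpark (trainMatrix T c)) {Γ : Finset (Fin L × Fin L)} {H : Op}
    (hH : H ∈ opClass T L Γ) (hind : CellsIndependent T L Γ H) :
    StablyIdentifiesIn (diracTrain T c) (blindClass T L Δ) H := by
  obtain ⟨α, hα, h⟩ := exists_stabilityBounds hT hΔ hc hH hind
  exact stablyIdentifiesIn_of_stabilityBounds hα (one_le_upperBound T c) h

theorem stablyIdentifies_opClass (hT : 0 < T) [NeZero L] {c : ZMod L → ℂ}
    {Γ : Finset (Fin L × Fin L)} (hc : LinearIndepOn ℂ (trainMatrix T c).col Γ) :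
    StablyIdentifies (diracTrain T c) (opClass T L Γ : Set Op) := by
  have hL : (0 : ℝ) < L := Nat.cast_pos.2 (NeZero.pos L)
  obtain ⟨V, hV, hlow⟩ := exists_norm_le_zakMap hc
  exact stablyIdentifies_of_stabilityBounds (by positivity) (one_le_upperBound T c)
    fun H₁ h₁ H₂ h₂ => stabilityBounds_of_norm_le hT c h₁ h₂ hV (hlow _ (sub_mem h₁ h₂))

/-- The operators of `X(Δ)` that the Dirac train separates from all of `X(Δ)` with lower stability
constant `1/(n + 1)`. -/
def stableClass (T : ℝ) {L : ℕ} (c : ZMod L → ℂ) (Δ : ℝ) (n : ℕ) : Set Op :=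
  {H ∈ blindClass T L Δ | ∀ H' ∈ blindClass T L Δ,
    StabilityBounds (diracTrain T c) (1 / ((n : ℝ) + 1)) (upperBound T c) H H'}

theorem stableClass_subset (c : ZMod L → ℂ) (Δ : ℝ) (n : ℕ) :
    stableClass T c Δ n ⊆ blindClass T L Δ :=
  fun _ hH => hH.1

theorem monotone_stableClass (T : ℝ) (c : ZMod L → ℂ) (Δ : ℝ) : Monotone (stableClass T c Δ) :=
  fun _ _ hmn _ hH => ⟨hH.1, fun H' hH' => (hH.2 H' hH').mono (Nat.one_div_le_one_div hmn)⟩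

theorem stablyIdentifies_stableClass (c : ZMod L → ℂ) (Δ : ℝ) (n : ℕ) :
    StablyIdentifies (diracTrain T c) (stableClass T c Δ n) :=
  stablyIdentifies_of_stabilityBounds Nat.one_div_pos_of_nat (one_le_upperBound T c)
    fun _ h₁ _ h₂ => h₁.2 _ h₂.1

theorem mem_iUnion_stableClass (hT : 0 < T) [NeZero L] {Δ : ℝ} (hΔ : Δ < 1) {c : ZMod L → ℂ}
    (hc : HasFullSpark (trainMatrix T c)) {Γ : Finset (Fin L × Fin L)} (hΓ : area T L Γ ≤ Δ)
    {H : Op} (hH : H ∈ opClass T L Γ) (hind : CellsIndependent T L Γ H) :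
    H ∈ ⋃ n, stableClass T c Δ n := by
  obtain ⟨α, hα, h⟩ := exists_stabilityBounds hT hΔ hc hH hind
  obtain ⟨n, hn⟩ := exists_nat_one_div_lt hα
  exact Set.mem_iUnion.2 ⟨n, mem_blindClass.2 ⟨Γ, hΓ, hH⟩, fun H' hH' => (h H' hH').mono hn.le⟩

/-! ### Recovery -/

theorem transpose_gram_mulVec_eq_zero_iff {𝕜 E ι : Type*} [RCLike 𝕜] [NormedAddCommGroup E]
    [InnerProductSpace 𝕜 E] [Fintype ι] (z : ι → E) (v : ι → 𝕜) :
    (Matrix.gram 𝕜 z)ᵀ *ᵥ v = 0 ↔ ∑ i, star v i • z i = 0 := by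
  have hinner : ∀ j, ((Matrix.gram 𝕜 z)ᵀ *ᵥ v) j = inner 𝕜 (∑ i, star v i • z i) (z j) := by
    intro j
    simp [Matrix.mulVec, dotProduct, sum_inner, inner_smul_left, mul_comm]
  constructor <;> intro h
  · refine (inner_self_eq_zero (𝕜 := 𝕜)).1 ?_
    rw [inner_sum]
    exact Finset.sum_eq_zero fun j _ => by rw [inner_smul_right, ← hinner, h]; simp
  · ext j
    rw [hinner, h, inner_zero_left, Pi.zero_apply]

theorem correlationMatrix_eq_transpose_gram {c : ZMod L → ℂ} {H : Op} {ζ : ℝ × ℝ → ℂ}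
    (hζ : ∀ᵐ u ∂volume.restrict (cell T L),
      zakVector T L ζ u = trainMatrix T c *ᵥ fun i => cellComponent T L H i u) :
    correlationMatrix T L ζ = (Matrix.gram ℂ fun p => zakMap T c H p)ᵀ := by
  ext p q
  rw [Matrix.transpose_apply, Matrix.gram_apply, L2.inner_def, correlationMatrix,
    Matrix.of_apply]
  refine integral_congr_ae ?_
  filter_upwards [hζ, coeFn_zakMap c H p, coeFn_zakMap c H q] with u hu hp hq
  rw [hu, hp, hq, RCLike.inner_apply]

theorem correlationMatrix_mulVec_eq_zero_iff {c : ZMod L → ℂ} {Γ : Finset (Fin L × Fin L)}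
    {H : Op} (hH : H ∈ opClass T L Γ) (hind : CellsIndependent T L Γ H) {ζ : ℝ × ℝ → ℂ}
    (hζ : ∀ᵐ u ∂volume.restrict (cell T L),
      zakVector T L ζ u = trainMatrix T c *ᵥ fun i => cellComponent T L H i u)
    (v : Fin L → ℂ) :
    correlationMatrix T L ζ *ᵥ v = 0 ↔ ∀ i ∈ Γ, (star v ᵥ* trainMatrix T c) i = 0 := by
  rw [correlationMatrix_eq_transpose_gram hζ, transpose_gram_mulVec_eq_zero_iff,
    sum_smul_zakMap c hH]
  exact ⟨linearIndepOn_finset_iff.1 (cellsIndependent_iff.1 hind) _,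
    fun h => Finset.sum_eq_zero fun i hi => by rw [h i hi, zero_smul]⟩

theorem col_conjTranspose_mul_eq_zero_iff {𝕜 m n ι : Type*} [CommRing 𝕜] [StarRing 𝕜]
    [Fintype m] (B : Matrix m ι 𝕜) (A : Matrix m n 𝕜) (j : n) :
    (Bᴴ * A).col j = 0 ↔
      ∀ v ∈ Submodule.span 𝕜 (Set.range B.col), (star v ᵥ* A) j = 0 := by
  classical
  have hker : ∀ v : m → 𝕜,
      (star v ᵥ* A) j = 0 ↔ v ∈ LinearMap.ker (dotProductEquiv 𝕜 m (star (A.col j))) := by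
    intro v
    rw [LinearMap.mem_ker, dotProductEquiv_apply_apply, Matrix.star_dotProduct, star_eq_zero]
    rfl
  simp only [hker]
  rw [← SetLike.le_def, Submodule.span_le, Set.range_subset_iff]
  simp only [SetLike.mem_coe, ← hker]
  exact funext_iff

theorem supportRecovered_of_zakVector_ae_eq {c : ZMod L → ℂ}
    (hc : HasFullSpark (trainMatrix T c)) {Γ : Finset (Fin L × Fin L)} (hΓ : Γ.card < L) {H : Op}
    (hH : H ∈ opClass T L Γ) (hind : CellsIndependent T L Γ H) {ζ : ℝ × ℝ → ℂ}
    (hζ : ∀ᵐ u ∂volume.restrict (cell T L),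
      zakVector T L ζ u = trainMatrix T c *ᵥ fun i => cellComponent T L H i u) :
    SupportRecovered T c ζ Γ := by
  intro r Un hUn i
  simp only [col_conjTranspose_mul_eq_zero_iff, hUn, LinearMap.mem_ker, Matrix.mulVecLin_apply,
    correlationMatrix_mulVec_eq_zero_iff hH hind hζ]
  refine ⟨fun h => ?_, fun hi v hv => hv i hi⟩
  by_contra hi
  obtain ⟨v, hvi, hvΓ⟩ := hc.exists_vecMul_eq_one (by simpa using hΓ) hi
  refine one_ne_zero (hvi.symm.trans ?_)
  simpa only [star_star] using h (star v) (by simpa only [star_star] using hvΓ)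

theorem rank_submatrix_eq_card {𝕜 m n : Type*} [Field 𝕜] [Finite m] {A : Matrix m n 𝕜}
    {Λ : Finset n} (hA : LinearIndepOn 𝕜 A.col Λ) :
    (A.submatrix id (Subtype.val : Λ → n)).rank = Λ.card := by
  have := Fintype.ofFinite m
  rw [← Matrix.rank_transpose, LinearIndependent.rank_matrix (by exact hA), Fintype.card_coe]

theorem ae_cellComponent_eq_zero {Γ : Finset (Fin L × Fin L)} {H : Op}
    (hH : H ∈ opClass T L Γ) :
    ∀ᵐ u ∂volume.restrict (cell T L), ∀ i, i ∉ Γ → cellComponent T L H i u = 0 := by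
  refine eventually_all.2 fun i => ?_
  by_cases hi : i ∈ Γ
  · exact Eventually.of_forall fun u h => absurd hi h
  have hcoe := coeFn_cellMap (T := T) H i
  rw [cellMap_eq_zero hH hi] at hcoe
  filter_upwards [hcoe, Lp.coeFn_zero ℂ 2 (volume.restrict (cell T L))] with u hu hzero _
  rw [← hu, hzero, Pi.zero_apply]

theorem spreadingRecovered_of_zakVector_ae_eq {c : ZMod L → ℂ} {Γ : Finset (Fin L × Fin L)}
    (hc : LinearIndepOn ℂ (trainMatrix T c).col Γ) {H : Op} (hH : H ∈ opClass T L Γ)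
    {ζ : ℝ × ℝ → ℂ}
    (hζ : ∀ᵐ u ∂volume.restrict (cell T L),
      zakVector T L ζ u = trainMatrix T c *ᵥ fun i => cellComponent T L H i u) :
    SpreadingRecovered T c ζ Γ H := by
  refine ⟨rank_submatrix_eq_card hc, ?_⟩
  filter_upwards [hζ, ae_cellComponent_eq_zero hH] with u hu hzero v
  have hsolution :
      activeMatrix T c Γ *ᵥ (fun i : Γ => cellComponent T L H i u) = zakVector T L ζ u := by
    rw [hu]
    ext p
    simp only [Matrix.mulVec, dotProduct, activeMatrix, Matrix.submatrix_apply, id]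
    rw [Finset.sum_coe_sort Γ fun i => trainMatrix T c p i * cellComponent T L H i u]
    exact Finset.sum_subset (Finset.subset_univ Γ) fun i _ hi => by rw [hzero i hi, mul_zero]
  rw [← hsolution]
  exact (Matrix.mulVec_injective_iff.2 hc).eq_iff

theorem recovery_of_isResponse (hT : 0 < T) [NeZero L] {c : ZMod L → ℂ}
    (hc : HasFullSpark (trainMatrix T c)) {Γ : Finset (Fin L × Fin L)} (hΓ : Γ.card < L) {H : Op}
    (hH : H ∈ opClass T L Γ) (hind : CellsIndependent T L Γ H)
    {y : Lp ℂ 2 (volume : Measure ℝ)} (hy : IsResponse H (diracTrain T c) y) :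
    (∃ ζ, IsZakTransform (T * L) y ζ) ∧ ∀ ζ, IsZakTransform (T * L) y ζ →
      SupportRecovered T c ζ Γ ∧ SpreadingRecovered T c ζ Γ H := by
  obtain ⟨y', hy', hzak, -⟩ := exists_isResponse hT c (opClass_mono (Finset.subset_univ Γ) hH)
  rw [hy'.unique hy] at hzak
  refine ⟨⟨_, hzak⟩, fun ζ hζ => ?_⟩
  have hae := zakVector_ae_eq_mulVec c hzak hζ
  exact ⟨supportRecovered_of_zakVector_ae_eq hc hΓ hH hind hae,
    spreadingRecovered_of_zakVector_ae_eq (hc Γ (by simpa using hΓ.le)) hH hae⟩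

end OperatorId

end

theorem theorem3 (T : ℝ) (hT : 0 < T) (L : ℕ) [NeZero L] (Δ : ℝ) (hΔ : Δ < 1) :
    ∃ c : ZMod L → ℂ,
      -- almost every operator in `X(Δ)` is stably identified among all operators in `X(Δ)`
      AlmostAll T L Δ {H | StablyIdentifiesIn (diracTrain T c) (blindClass T L Δ) H} ∧
      -- almost all of `X(Δ)` is exhausted by sets that are stably identified
      (∃ Q : ℕ → Set Op, Monotone Q ∧
        (∀ n, Q n ⊆ blindClass T L Δ ∧ StablyIdentifies (diracTrain T c) (Q n)) ∧
        AlmostAll T L Δ (⋃ n, Q n)) ∧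
      -- every class with known support region is stably identified as a whole
      (∀ Γ : Finset (Fin L × Fin L), area T L Γ ≤ Δ →
        StablyIdentifies (diracTrain T c) (opClass T L Γ : Set Op)) ∧
      -- almost all operators in `X(Δ)` have linearly independent active components
      AlmostAll T L Δ {H | ∃ Γ : Finset (Fin L × Fin L), area T L Γ ≤ Δ ∧
        H ∈ opClass T L Γ ∧ CellsIndependent T L Γ H} ∧
      -- and these are the operators that the algorithm recovers
      (∀ Γ : Finset (Fin L × Fin L), area T L Γ ≤ Δ → ∀ H ∈ opClass T L Γ,
        CellsIndependent T L Γ H →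
          StablyIdentifiesIn (diracTrain T c) (blindClass T L Δ) H ∧
          ∀ y : Lp ℂ 2 (volume : Measure ℝ), IsResponse H (diracTrain T c) y →
            (∃ ζ, IsZakTransform (T * L) y ζ) ∧
            ∀ ζ, IsZakTransform (T * L) y ζ →
              SupportRecovered T c ζ Γ ∧ SpreadingRecovered T c ζ Γ H) := by
  obtain ⟨c, hc⟩ := exists_hasFullSpark_trainMatrix hT.ne' L
  have hcard : ∀ {Γ : Finset (Fin L × Fin L)}, area T L Γ ≤ Δ → Γ.card < L :=
    fun hΓ => card_lt_of_area_lt_one hT (hΓ.trans_lt hΔ)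
  have hall := almostAll_cellsIndependent (L := L) hT Δ
  refine ⟨c, ?_, ?_, ?_, hall, ?_⟩
  · exact hall.mono fun H _ ⟨_, _, hH, hind⟩ =>
      stablyIdentifiesIn_of_cellsIndependent hT hΔ hc hH hind
  · exact ⟨stableClass T c Δ, monotone_stableClass T c Δ,
      fun n => ⟨stableClass_subset c Δ n, stablyIdentifies_stableClass c Δ n⟩,
      hall.mono fun H _ ⟨_, hΓ, hH, hind⟩ => mem_iUnion_stableClass hT hΔ hc hΓ hH hind⟩
  · exact fun Γ hΓ => stablyIdentifies_opClass hT (hc Γ (by simpa using (hcard hΓ).le))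
  · exact fun Γ hΓ H hH hind => ⟨stablyIdentifiesIn_of_cellsIndependent hT hΔ hc hH hind,
      fun y hy => recovery_of_isResponse hT hc (hcard hΓ) hH hind hy⟩
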